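/- \textbf{Proposition (a variant of the Canonical Element Theorem).} Rings are commutative and Noetherian. Let $(S,\mathfrak m)$ be a local ring of dimension $d\ge 1$. \emph{Data.} Consider a system of parameters $\mathbf x=x_1,\dots,x_d$ of $S$, an ideal $\mathfrak q$ of height $d-1$ containing $x_2,\dots,x_d$ (hence not $x_1$), an integer $w\ge 1$, and a (not necessarily minimal) free resolution $G_\bullet$ of $S/(\mathfrak q,x_1^w)$. \emph{Notation.} Put $\mathrm{syz}^{G_\bullet}_d:=G_d/\mathrm{im}(\partial^{G_\bullet}_{d+1})$. Let $K_\bullet(\mathbf y;S)$ be the Koszul complex of $\mathbf y=y_1,\dots,y_d$, and write $1$ for the generator $e_1\wedge\dots\wedge e_d$ of $K_d(\mathbf y;S)\cong S$. For an ideal $I$ and an $S$-module $M$ let $H^n_I(M):=\varinjlim_m \mathrm{Ext}^n_S(S/I^m,M)$, and let $\Theta^M_I:\mathrm{Ext}^d_S(S/I,M)\to H^d_I(M)$ be the natural map. For an $\mathfrak m$-primary ideal $I$ and a free resolution $F_\bullet$ of $S/I$, the canonical element $\eta_I\in H^d_I(\mathrm{syz}^{F_\bullet}_d)$ is the image under $\Theta_I$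 of the class in $\mathrm{Ext}^d_S(S/I,\mathrm{syz}^{F_\bullet}_d)$ of the natural epimorphism $F_d\to\mathrm{syz}^{F_\bullet}_d$; below, $x_1^{w-1}\eta_{(\mathfrak q,x_1^w)}\ne0$ means that this holds for every free resolution $F_\bullet$ of $S/(\mathfrak q,x_1^w)$. A canonical module of $S$ is a finitely generated $S$-module $\omega_S$ with $\mathrm{Hom}_S(\omega_S,E_S(S/\mathfrak m))\cong H^d_{\mathfrak m}(S)$. The following statements (i)--(iv) are equivalent. If $S$ admits a canonical module $\omega_S$, then for every such $\omega_S$ all of (i)--(vi) are equivalent. (i) For all data $\mathbf x,\mathfrak q,w,G_\bullet$, every chain map $\phi_\bullet:K_\bullet(x_1^w,x_2,\dots,x_d;S)\to G_\bullet$ inducing $r+(x_1^w,x_2,\dots,x_d)\mapsto r+(\mathfrak q,x_1^w)$ on $0$-th homologies, and every integer $v\ge1$, $$(x_1^{wv-w}x_2^{v-1}\cdots x_d^{v-1})\cdot\big(x_1^{w-1}\phi_d(1)\big)+\mathrm{im}(\partial^{G_\bullet}_{d+1})\notin(x_1^{wv},x_2^v,\dots,x_d^v)\,\mathrm{syz}^{G_\bullet}_d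 .$$ (ii) The same with $v=1$ only: for all data and all $\phi_\bullet$ as in (i), $$x_1^{w-1}\phi_d(1)+\mathrm{im}(\partial^{G_\bullet}_{d+1})\notin(x_1^w,x_2,\dots,x_d)\,\mathrm{syz}^{G_\bullet}_d .$$ (iii) For all data $\mathbf x,\mathfrak q,w,G_\bullet$ and every chain map $\phi_\bullet:K_\bullet(x_1^w,x_2,\dots,x_d;S)\to G_\bullet$ inducing $r+(x_1^w,x_2,\dots,x_d)\mapsto x_1^{w-1}r+(\mathfrak q,x_1^w)$ on $0$-th homologies, $\phi_d\ne0$. (iv) For all $\mathbf x,\mathfrak q,w$ as above, $x_1^{w-1}\eta_{(\mathfrak q,x_1^w)}\ne0$. (v) For all $\mathbf x,\mathfrak q,w$ as above, the composition $$\mathrm{Ext}^d_S\big(S/(\mathfrak q,x_1^w),\omega_S\big)\xrightarrow{\mathrm{Ext}^d_S(\nu_w,\mathrm{id})}\mathrm{Ext}^d_S\big(S/(\mathfrak q,x_1),\omega_S\big)\xrightarrow{\Theta^{\omega_S}_{(\mathfrak q,x_1)}}H^d_{(\mathfrak q,x_1)}(\omega_S)$$ is non-zero, where $\nu_w:S/(\mathfrak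 q,x_1)\to S/(\mathfrak q,x_1^w)$ is multiplication by $x_1^{w-1}$. (vi) For all $\mathbf x,\mathfrak q,w$ as above, the composition $$\mathrm{Ext}^d_S\big(S/(\mathfrak q,x_1^w),\omega_S\big)\xrightarrow{\Theta^{\omega_S}_{(\mathfrak q,x_1^w)}}H^d_{(\mathfrak q,x_1^w)}(\omega_S)\xrightarrow{x_1^{w-1}}H^d_{(\mathfrak q,x_1^w)}(\omega_S)$$ is non-zero. -/

import Mathlib

open CategoryTheory CategoryTheory.Abelian IsLocalRing

universe u

noncomputable section

namespace CanonicalElement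

variable {S : Type u} [CommRing S]

/-! ### The Koszul complex -/

/-- The linear form `S^d → S`, `e_i ↦ y_i`, attached to a sequence `y = y_1, …, y_d`. -/
def koszulForm {d : ℕ} (y : Fin d → S) : Module.Dual S (Fin d → S) :=
  Fintype.linearCombination S y

/-- Contraction with a linear form lowers the degree of an exterior product by one. -/
theorem contractLeft_mem {M : Type u} [AddCommGroup M] [Module S M] (f : Module.Dual S M) :
    ∀ (n : ℕ) (z : ExteriorAlgebra S M), z ∈ ⋀[S]^(n + 1) M →
      CliffordAlgebra.contractLeft (Q := (0 : QuadraticForm S M)) f z ∈ ⋀[S]^n M := by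
  intro n
  induction n with
  | zero =>
    intro z hz
    rw [ExteriorAlgebra.exteriorPower, zero_add, pow_one] at hz
    obtain ⟨m, rfl⟩ := hz
    have h : CliffordAlgebra.contractLeft (Q := (0 : QuadraticForm S M)) f
        (ExteriorAlgebra.ι S m) = algebraMap S _ (f m) :=
      CliffordAlgebra.contractLeft_ι (Q := (0 : QuadraticForm S M)) f m
    rw [h, ExteriorAlgebra.exteriorPower, pow_zero]
    exact Submodule.algebraMap_mem _
  | succ n ih =>
    intro z hz
    rw [ExteriorAlgebra.exteriorPower, pow_succ'] at hz
    induction hz using Submodule.mul_induction_on' with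
    | mem_mul_mem a ha b hb =>
      obtain ⟨m, rfl⟩ := ha
      have h : CliffordAlgebra.contractLeft (Q := (0 : QuadraticForm S M)) f
          (ExteriorAlgebra.ι S m * b) = f m • b - ExteriorAlgebra.ι S m *
            CliffordAlgebra.contractLeft (Q := (0 : QuadraticForm S M)) f b :=
        CliffordAlgebra.contractLeft_ι_mul (Q := (0 : QuadraticForm S M)) f m b
      rw [h]
      refine Submodule.sub_mem _ (Submodule.smul_mem _ _ hb) ?_
      rw [ExteriorAlgebra.exteriorPower, pow_succ']
      exact Submodule.mul_mem_mul ⟨m, rfl⟩ (ih b hb)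
    | add a _ b _ ha hb =>
      rw [map_add]
      exact Submodule.add_mem _ ha hb

/-- The Koszul differential `⋀^{n+1} S^d → ⋀^n S^d`,
`v_0 ∧ ⋯ ∧ v_n ↦ ∑ (-1)^i f(v_i) v_0 ∧ ⋯ v̂_i ⋯ ∧ v_n`, where `f` is the linear form of `y`. -/
def koszulD {d : ℕ} (y : Fin d → S) (n : ℕ) :
    ⋀[S]^(n + 1) (Fin d → S) →ₗ[S] ⋀[S]^n (Fin d → S) :=
  (CliffordAlgebra.contractLeft (Q := (0 : QuadraticForm S (Fin d → S))) (koszulForm y)).restrict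
    (contractLeft_mem (koszulForm y) n)

theorem koszulD_comp_koszulD {d : ℕ} (y : Fin d → S) (n : ℕ) :
    koszulD y n ∘ₗ koszulD y (n + 1) = 0 := by
  refine LinearMap.ext fun z => ?_
  exact Subtype.ext (CliffordAlgebra.contractLeft_contractLeft
    (Q := (0 : QuadraticForm S (Fin d → S))) (koszulForm y) z.1)

/-- The Koszul complex `K_•(y_1, …, y_d; S)`, with `K_n = ⋀^n S^d`. -/
def koszulComplex {d : ℕ} (y : Fin d → S) : ChainComplex (ModuleCat.{u} S) ℕ :=
  ChainComplex.of (fun n => ModuleCat.of S (⋀[S]^n (Fin d → S)))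
    (fun n => ModuleCat.ofHom (koszulD y n))
    (fun n => by
      rw [← ModuleCat.ofHom_comp, koszulD_comp_koszulD]
      rfl)

/-- The element `r ∈ S = K_0(y; S)`. -/
def koszulBot {d : ℕ} (y : Fin d → S) (r : S) : (koszulComplex y).X 0 :=
  (r • exteriorPower.ιMulti S 0 (fun i : Fin 0 => i.elim0) : ⋀[S]^0 (Fin d → S))

/-- The generator `1 = e_1 ∧ ⋯ ∧ e_d ∈ S = K_d(y; S)`. -/
def koszulTop {d : ℕ} (y : Fin d → S) : (koszulComplex y).X d :=
  (exteriorPower.ιMulti S d (fun i : Fin d => Pi.single i (1 : S)) : ⋀[S]^d (Fin d → S))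

/-! ### Free resolutions and syzygies -/

/-- The cyclic module `S/I`. -/
abbrev cyc (I : Ideal S) : ModuleCat.{u} S := ModuleCat.of S (S ⧸ I)

/-- A (not necessarily minimal) free resolution of `S/I`. -/
structure FreeResolution (I : Ideal S) where
  /-- the underlying projective resolution -/
  res : ProjectiveResolution (cyc I)
  free : ∀ n, Module.Free S (res.complex.X n)

variable {I : Ideal S}

/-- The augmentation `G_0 → S/I`. -/
def FreeResolution.aug (G : FreeResolution I) : G.res.complex.X 0 →ₗ[S] S ⧸ I :=
  (G.res.π.f 0).hom

/-- The syzygy `syz_n = G_n / im(∂_{n+1})`. -/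
abbrev FreeResolution.syz (G : FreeResolution I) (n : ℕ) : Type u :=
  G.res.complex.X n ⧸ LinearMap.range (G.res.complex.d (n + 1) n).hom

/-- The natural epimorphism `G_n → syz_n`. -/
abbrev FreeResolution.toSyz (G : FreeResolution I) (n : ℕ) : G.res.complex.X n →ₗ[S] G.syz n :=
  Submodule.mkQ _

/-- The chain map `φ : K_•(y; S) → G_•` induces on `0`-th homologies the map
`S/(y) → S/I`, `r + (y) ↦ c r + I`. -/
def LiftsMul {d : ℕ} {y : Fin d → S} {G : FreeResolution I}
    (φ : koszulComplex y ⟶ G.res.complex) (c : S) : Prop :=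
  ∀ r : S, G.aug ((φ.f 0).hom (koszulBot y r)) = Ideal.Quotient.mk I (c * r)

/-! ### `Ext`, local cohomology and the canonical element -/

/-- `Ext^n_S(M, N) → Ext^n_S(M', N)` induced by a linear map `M' → M`. -/
def extMap {M M' : ModuleCat.{u} S} (f : M' ⟶ M) (N : ModuleCat.{u} S) (n : ℕ) :
    Ext M N n →ₗ[S] Ext M' N n :=
  (Ext.mk₀ f).precompOfLinear S N (zero_add n)

/-- The natural epimorphism `S/J → S/I` for `J ⊆ I`. -/
def cycMap {J I : Ideal S} (h : J ≤ I) : cyc J ⟶ cyc I :=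
  ModuleCat.ofHom (Submodule.factor h)

/-- Local cohomology `H^n_I(M)`, the direct limit of the modules `Ext^n_S(S/I^m, M)` along the
maps induced by `S/I^{m'} → S/I^m`, `m ≤ m'`. -/
abbrev LocCoh (I : Ideal S) (n : ℕ) (M : ModuleCat.{u} S) : Type u :=
  Module.DirectLimit (fun m : ℕ => Ext (cyc (I ^ m)) M n)
    (fun _ _ h => extMap (cycMap (Ideal.pow_le_pow_right h)) M n)

/-- The natural map `Θ^M_I : Ext^n_S(S/I, M) → H^n_I(M)`, through the index `m = 1`. -/
def theta (I : Ideal S) (n : ℕ) (M : ModuleCat.{u} S) : Ext (cyc I) M n →ₗ[S] LocCoh I n M :=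
  Module.DirectLimit.of S ℕ (fun m : ℕ => Ext (cyc (I ^ m)) M n)
      (fun _ _ h => extMap (cycMap (Ideal.pow_le_pow_right h)) M n) 1 ∘ₗ
    extMap (cycMap (pow_one I).le) M n

/-- The class `ε_I ∈ Ext^n_S(S/I, syz_n)` of the cocycle `G_n → syz_n`. -/
def FreeResolution.epsilon (G : FreeResolution I) (n : ℕ) :
    Ext (cyc I) (ModuleCat.of S (G.syz n)) n :=
  G.res.extMk (ModuleCat.ofHom (G.toSyz n)) (n + 1) rfl (by
    ext z
    exact (Submodule.Quotient.mk_eq_zero _).2 ⟨z, rfl⟩)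

/-- The image `η_I ∈ H^n_I(syz_n)` of `ε_I`; for `S` local of dimension `n` and `I` primary to
the maximal ideal, this is the canonical element of `S` with respect to `I`. -/
def FreeResolution.eta (G : FreeResolution I) (n : ℕ) :
    LocCoh I n (ModuleCat.of S (G.syz n)) :=
  theta I n _ (G.epsilon n)

/-! ### Canonical modules -/

/-- `j : S/𝔪 → E` is an injective hull of the residue field. -/
structure IsInjectiveHullResidueField [IsLocalRing S] {E : Type u} [AddCommGroup E] [Module S E]
    (j : ResidueField S →ₗ[S] E) : Prop where
  injective_map : Function.Injective j
  injective_module : Module.Injective.{u, u} S E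
  essential : ∀ N : Submodule S E, N ≠ ⊥ → N ⊓ LinearMap.range j ≠ ⊥

/-- `ω` is a canonical module of the local ring `S` of dimension `n`: it is finitely generated
and `Hom_S(ω, E(S/𝔪)) ≅ H^n_𝔪(S)`. -/
def IsCanonicalModule [IsLocalRing S] (ω : ModuleCat.{u} S) : Prop :=
  Module.Finite S ω ∧
    ∃ n : ℕ, ringKrullDim S = n ∧
      ∃ (E : ModuleCat.{u} S) (j : ResidueField S →ₗ[S] E), IsInjectiveHullResidueField j ∧
        Nonempty ((ω →ₗ[S] E) ≃ₗ[S] LocCoh (maximalIdeal S) n (ModuleCat.of S S))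

/-! ### The data and the six statements -/

/-- `x = x_1, …, x_d` generates an ideal primary to the maximal ideal. (For `d = dim S` this
says that `x` is a system of parameters.) -/
def GeneratesPrimary [IsLocalRing S] {d : ℕ} (x : Fin d → S) : Prop :=
  (Ideal.span (Set.range x)).radical = maximalIdeal S

/-- The data, for `S` local of dimension `d`: a system of parameters `x_1, …, x_d` (with `x_1`
written `x 0`), an ideal `q` of height `d - 1` containing `x_2, …, x_d`, and `w ≥ 1`. -/
structure IsDatum [IsLocalRing S] {d : ℕ} [NeZero d] (x : Fin d → S) (q : Ideal S) (w : ℕ) :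
    Prop where
  sop : GeneratesPrimary x
  height_eq : q.height = ((d - 1 : ℕ) : ℕ∞)
  mem : ∀ i, i ≠ 0 → x i ∈ q
  one_le : 1 ≤ w

/-- The ideal `(q, a)`. -/
abbrev adjoin (q : Ideal S) (a : S) : Ideal S := q ⊔ Ideal.span {a}

/-- The sequence `x_1^w, x_2, …, x_d`. -/
def seqPow {d : ℕ} [NeZero d] (x : Fin d → S) (w : ℕ) : Fin d → S :=
  Function.update x 0 (x 0 ^ w)

/-- The multiplication map `ν_w : S/(q, a) → S/(q, a^w)` by `a^{w-1}`. -/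
def nu (q : Ideal S) (a : S) (w : ℕ) (hw : 1 ≤ w) : cyc (adjoin q a) ⟶ cyc (adjoin q (a ^ w)) :=
  ModuleCat.ofHom (Submodule.mapQ _ _ (LinearMap.mulLeft S (a ^ (w - 1))) (by
    refine sup_le (fun z hz => ?_) ?_
    · exact Ideal.mem_sup_left (Ideal.mul_mem_left _ _ hz)
    · rw [Ideal.span_le, Set.singleton_subset_iff]
      refine Ideal.mem_sup_right ?_
      have h : a ^ (w - 1) * a = a ^ w := by rw [← pow_succ, Nat.sub_add_cancel hw]
      simp [h]))

/-- For a chain map `φ : K_•(x_1^w, x_2, …, x_d; S) → G_•` and `v`: the relation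
`x_1^{wv-w} x_2^{v-1} ⋯ x_d^{v-1} · (x_1^{w-1} φ_d(1)) + im ∂_{d+1} ∈ (x_1^{wv}, x_2^v, …, x_d^v) syz_d`. -/
def BadRelation {d : ℕ} [NeZero d] (x : Fin d → S)
    (w : ℕ) {G : FreeResolution I} (φ : koszulComplex (seqPow x w) ⟶ G.res.complex)
    (v : ℕ) : Prop :=
  G.toSyz d ((∏ i, seqPow x w i ^ (v - 1)) •
      (x 0 ^ (w - 1) • (φ.f d).hom (koszulTop (seqPow x w)))) ∈
    Ideal.span (Set.range fun i => seqPow x w i ^ v) • (⊤ : Submodule S (G.syz d))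

variable (S) (d : ℕ) [NeZero d] [IsLocalRing S]

/-- Non-membership for all lifts of the natural epimorphism and all `v ≥ 1`. -/
def MonomialForm : Prop :=
  ∀ (x : Fin d → S) (q : Ideal S) (w : ℕ), IsDatum x q w →
    ∀ (G : FreeResolution (adjoin q (x 0 ^ w)))
      (φ : koszulComplex (seqPow x w) ⟶ G.res.complex), LiftsMul φ 1 →
      ∀ v : ℕ, 1 ≤ v → ¬ BadRelation x w φ v

/-- Non-membership for all lifts of the natural epimorphism and `v = 1`. -/
def MonomialFormOne : Prop :=
  ∀ (x : Fin d → S) (q : Ideal S) (w : ℕ), IsDatum x q w →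
    ∀ (G : FreeResolution (adjoin q (x 0 ^ w)))
      (φ : koszulComplex (seqPow x w) ⟶ G.res.complex), LiftsMul φ 1 →
      G.toSyz d (x 0 ^ (w - 1) • (φ.f d).hom (koszulTop (seqPow x w))) ∉
        Ideal.span (Set.range (seqPow x w)) • (⊤ : Submodule S (G.syz d))

/-- `φ_d ≠ 0` for all lifts of multiplication by `x_1^{w-1}`. -/
def LiftForm : Prop :=
  ∀ (x : Fin d → S) (q : Ideal S) (w : ℕ), IsDatum x q w →
    ∀ (G : FreeResolution (adjoin q (x 0 ^ w)))
      (φ : koszulComplex (seqPow x w) ⟶ G.res.complex), LiftsMul φ (x 0 ^ (w - 1)) →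
      φ.f d ≠ 0

/-- `x_1^{w-1} η_{(q, x_1^w)} ≠ 0`, whichever free resolution defines the canonical element. -/
def EtaForm : Prop :=
  ∀ (x : Fin d → S) (q : Ideal S) (w : ℕ), IsDatum x q w →
    ∀ G : FreeResolution (adjoin q (x 0 ^ w)), x 0 ^ (w - 1) • G.eta d ≠ 0

variable {S}

/-- `Ext^d(S/(q, x_1^w), ω) → Ext^d(S/(q, x_1), ω) → H^d_{(q, x_1)}(ω)`, induced by `ν_w`
and followed by `Θ`, is non-zero. -/
def ExtNuForm (ω : ModuleCat.{u} S) : Prop :=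
  ∀ (x : Fin d → S) (q : Ideal S) (w : ℕ) (h : IsDatum x q w),
    theta (adjoin q (x 0)) d ω ∘ₗ extMap (nu q (x 0) w h.one_le) ω d ≠ 0

/-- `Ext^d(S/(q, x_1^w), ω) → H^d_{(q, x_1^w)}(ω) → H^d_{(q, x_1^w)}(ω)`, the map `Θ` followed
by multiplication by `x_1^{w-1}`, is non-zero. -/
def ExtMulForm (ω : ModuleCat.{u} S) : Prop :=
  ∀ (x : Fin d → S) (q : Ideal S) (w : ℕ), IsDatum x q w →
    LinearMap.lsmul S _ (x 0 ^ (w - 1)) ∘ₗ theta (adjoin q (x 0 ^ w)) d ω ≠ 0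

end CanonicalElement

end

noncomputable section

namespace CanonicalElement

variable {S : Type u} [CommRing S]

/-! ### Chain maps out of degreewise projective complexes -/

/-! Write `y = (x_1^w, x_2, …, x_d)`, `I = (q, x_1^w)` and `s = x_1^{w-1}`. Everything is expressed
through values `c(φ_d(1))` of cocycles `c : G_d → M` along chain maps `φ : K(y) → G`. Boundaries of
`K(y)` lie in `(y)K(y)`, so homotopies change such a value only within `(y)M`; conversely a map on
`K_d` whose value at the generator lies in `(y)M` is a coboundary (`exists_comp_dl_eq`).

Two lemmas translate between values and classes in `Ext`, for `φ` lifting a scalar. If that scalar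
times the class of `c` dies over `S/J` and `J` contains the `y_i^v`, then `∏ y_i^{v-1} c(φ_d(1)) ∈
(y^v)M` (`prod_smul_mem_of_smul_extMap_eq_zero`). If `c(φ_d(1)) ∈ (y)M`, then the scalar times the
class dies over `S/J` for all small `J` (`exists_smul_extMap_eq_zero`). The latter needs a chain map
from a resolution of `S/J` to `K(y)`. The Koszul complex need not be exact, but `(y)` kills its
homology, so by Artin–Rees cycles deep in the `(y)`-adic filtration are boundaries
(`exists_exactAlong_koszul`).

Applied to the cocycle `G_d → syz_d`, these give (i) ⇒ (iv) ⇒ (iii). For (iii) ⇒ (ii), a relation as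
in (ii) allows `s • φ` to be altered so that its top component vanishes. For (ii) ⇒ (i), the
exponent `v` is absorbed into the datum `(x_1, x_2^v, …, x_d^v)`, `q`, `wv`.

The class of `G_d → syz_d` is universal, whence (vi) ⇒ (iv). For (i) ⇒ (vi), `H^d_𝔪(S)` is the limit
of the `S/(y^v)` (`exists_locCoh_equiv_powLim`) and also `Hom(ω, E)`. If the map in (vi) were zero,
the class of `1 ∈ S/(y)`, read as a map `ω → E`, would kill every image in `ω` of the element `s
φ_d(1)` of `syz_d`. By injectivity of `E` its tensor product with that class is then zero
(`tmul_eq_zero_of_forall_apply_eq_zero`), which is a relation excluded by (i). Finally (v) ⇔ (vi),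
since both maps kill `ξ` exactly when `s ξ` dies over `S/J` for small `J`. -/

/-- The differential `C_{n+1} → C_n` as a linear map. -/
abbrev dl (C : ChainComplex (ModuleCat.{u} S) ℕ) (n : ℕ) : C.X (n + 1) →ₗ[S] C.X n :=
  (C.d (n + 1) n).hom

theorem dl_dl (C : ChainComplex (ModuleCat.{u} S) ℕ) (n : ℕ) (z : C.X (n + 2)) :
    dl C n (dl C (n + 1) z) = 0 := by
  have h := C.d_comp_d (n + 2) (n + 1) n
  exact congrArg (fun f => f.hom z) h

theorem comm_apply {C D : ChainComplex (ModuleCat.{u} S) ℕ} (φ : C ⟶ D) (n : ℕ)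
    (z : C.X (n + 1)) :
    dl D n ((φ.f (n + 1)).hom z) = (φ.f n).hom (dl C n z) :=
  congrArg (fun f => f.hom z) (φ.comm (n + 1) n)

/-- The chain map with given components. -/
def homOfComm {C D : ChainComplex (ModuleCat.{u} S) ℕ} (g : ∀ n, C.X n →ₗ[S] D.X n)
    (hg : ∀ n z, dl D n (g (n + 1) z) = g n (dl C n z)) : C ⟶ D where
  f n := ModuleCat.ofHom (g n)
  comm' := by
    rintro i j (rfl : j + 1 = i)
    ext z
    exact hg j z

/-- A linear map on a projective module whose values lift pointwise along `g` to elements of `A`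
lifts to a linear map with values in `A`. -/
theorem exists_lift_of_forall_exists {P M N : Type u} [AddCommGroup P] [Module S P]
    [AddCommGroup M] [Module S M] [AddCommGroup N] [Module S N] [Module.Projective S P]
    (g : M →ₗ[S] N) (A : Submodule S M) (f : P →ₗ[S] N) (h : ∀ p, ∃ z ∈ A, g z = f p) :
    ∃ l : P →ₗ[S] M, (∀ p, l p ∈ A) ∧ ∀ p, g (l p) = f p := by
  have hf : ∀ p, f p ∈ A.map g := fun p => by
    obtain ⟨z, hz, e⟩ := h p
    exact ⟨z, hz, e⟩
  have hs : Function.Surjective (g.submoduleMap A) := g.submoduleMap_surjective A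
  obtain ⟨l, hl⟩ := Module.projective_lifting_property (g.submoduleMap A) (f.codRestrict _ hf) hs
  refine ⟨A.subtype ∘ₗ l, fun p => (l p).2, fun p => ?_⟩
  exact congrArg Subtype.val (LinearMap.congr_fun hl p)

section Comparison

variable {C D : ChainComplex (ModuleCat.{u} S) ℕ} [∀ n, Module.Projective S (C.X n)]
  (A : ∀ n, Submodule S (D.X n))

/-- The submodules `A n` of `D_n` are exact in positive degrees: a cycle in `A (n + 1)` is the
boundary of an element of `A (n + 2)`. -/
def ExactAlong (A : ∀ n, Submodule S (D.X n)) : Prop :=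
  ∀ n, ∀ z ∈ A (n + 1), dl D n z = 0 → ∃ z' ∈ A (n + 2), dl D (n + 1) z' = z

variable {A}

/-- The comparison theorem relative to a family of submodules. With `A = ⊤` it serves resolutions;
with `A` made of `(y)`-adic pieces it serves Koszul complexes, which need not be exact. -/
theorem exists_hom_of_exactAlong (hA : ExactAlong A) (g₀ : C.X 0 →ₗ[S] D.X 0)
    (h₀ : ∀ p, ∃ z ∈ A 1, dl D 0 z = g₀ (dl C 0 p)) :
    ∃ φ : C ⟶ D, (∀ p, (φ.f 0).hom p = g₀ p) ∧ ∀ n p, (φ.f (n + 1)).hom p ∈ A (n + 1) := by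
  -- A state holds two consecutive components and their commutation relation, which is all that is
  -- needed to build the next component.
  let St : ℕ → Type u := fun n =>
    {s : (C.X n →ₗ[S] D.X n) × (C.X (n + 1) →ₗ[S] D.X (n + 1)) //
      (∀ p, s.2 p ∈ A (n + 1)) ∧ ∀ p, dl D n (s.2 p) = s.1 (dl C n p)}
  have step : ∀ n (s : St n), ∃ t : St (n + 1), t.1.1 = s.1.2 := by
    rintro n ⟨⟨a, b⟩, hb, hab⟩
    obtain ⟨l, hl, hl'⟩ := exists_lift_of_forall_exists (dl D (n + 1)) (A (n + 2))
      (b ∘ₗ dl C (n + 1)) (fun p => hA n _ (hb _) (by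
        simp only [LinearMap.comp_apply]
        rw [hab, dl_dl, map_zero]))
    exact ⟨⟨(b, l), hl, hl'⟩, rfl⟩
  choose next hnext using step
  obtain ⟨g₁, hg₁, hg₁'⟩ := exists_lift_of_forall_exists (dl D 0) (A 1) (g₀ ∘ₗ dl C 0) h₀
  let s : ∀ n, St n := fun n =>
    Nat.rec (motive := St) ⟨(g₀, g₁), hg₁, hg₁'⟩ (fun n s => next n s) n
  have hs : ∀ n, (s (n + 1)).1.1 = (s n).1.2 := fun n => hnext n (s n)
  refine ⟨homOfComm (fun n => (s n).1.1) (fun n z => ?_), fun p => rfl, fun n p => ?_⟩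
  · rw [hs n]
    exact (s n).2.2 z
  · change (s (n + 1)).1.1 p ∈ _
    rw [hs n]
    exact (s n).2.1 p

theorem exists_homotopy_of_exactAlong (hA : ExactAlong A) (δ : C ⟶ D)
    (h₀ : ∀ p, ∃ z ∈ A 1, dl D 0 z = (δ.f 0).hom p)
    (hδ : ∀ n p, (δ.f (n + 1)).hom p ∈ A (n + 1)) (n : ℕ) :
    ∃ h : C.X n →ₗ[S] D.X (n + 1), ∀ p : C.X (n + 1),
      ∃ z ∈ A (n + 2), dl D (n + 1) z = (δ.f (n + 1)).hom p - h (dl C n p) := by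
  -- Here `e` stands for the term `h_{n-1} ∘ ∂` of the homotopy formula, and is zero in degree `0`.
  -- The induction only has to remember that it kills boundaries.
  suffices H : ∃ (h : C.X n →ₗ[S] D.X (n + 1)) (e : C.X n →ₗ[S] D.X n), (∀ p, h p ∈ A (n + 1)) ∧
      (∀ p, dl D n (h p) = (δ.f n).hom p - e p) ∧ ∀ p, e (dl C n p) = 0 by
    obtain ⟨h, e, hh, hd, he⟩ := H
    refine ⟨h, fun p => hA n _ (Submodule.sub_mem _ (hδ n p) (hh _)) ?_⟩
    rw [map_sub, hd, comm_apply, he, sub_zero, sub_self]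
  induction n with
  | zero =>
    obtain ⟨h, hh, hd⟩ := exists_lift_of_forall_exists (dl D 0) (A 1) (δ.f 0).hom h₀
    exact ⟨h, 0, hh, fun p => by simp [hd], fun p => rfl⟩
  | succ n ih =>
    obtain ⟨h, e, hh, hd, he⟩ := ih
    obtain ⟨k, hk, hk'⟩ := exists_lift_of_forall_exists (dl D (n + 1)) (A (n + 2))
      ((δ.f (n + 1)).hom - h ∘ₗ dl C n) (fun p => by
        refine hA n _ (Submodule.sub_mem _ (hδ n p) (hh _)) ?_
        simp only [LinearMap.sub_apply, LinearMap.comp_apply]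
        rw [map_sub, hd, comm_apply, he, sub_zero, sub_self])
    refine ⟨k, h ∘ₗ dl C n, hk, hk', fun p => ?_⟩
    rw [LinearMap.comp_apply, dl_dl, map_zero]

end Comparison

/-! ### Projective resolutions of cyclic modules -/

section Resolutions

variable {I J : Ideal S} (R : ProjectiveResolution (cyc I))

/-- The augmentation of a projective resolution of `S/I`. -/
def resAug : R.complex.X 0 →ₗ[S] S ⧸ I := (R.π.f 0).hom

instance (n : ℕ) : Module.Projective S (R.complex.X n) :=
  (IsProjective.iff_projective _).2 (R.projective n)

theorem resAug_dl (z : R.complex.X 1) : resAug R (dl R.complex 0 z) = 0 :=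
  congrArg (fun f => f.hom z) R.complex_d_comp_π_f_zero

theorem resAug_surjective : Function.Surjective (resAug R) :=
  (ModuleCat.epi_iff_surjective (R.π.f 0)).1 inferInstance

theorem exists_dl_eq_of_resAug_eq_zero (z : R.complex.X 0) (hz : resAug R z = 0) :
    ∃ z', dl R.complex 0 z' = z :=
  (ShortComplex.moduleCat_exact_iff _).1 R.exact₀ z hz

theorem exactAlong_top : ExactAlong (D := R.complex) fun _ => ⊤ := fun n z _ hz => by
  obtain ⟨z', h⟩ := (ShortComplex.moduleCat_exact_iff _).1 (R.exact_succ n) z hz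
  exact ⟨z', trivial, h⟩

theorem exists_hom_to_resolution {C : ChainComplex (ModuleCat.{u} S) ℕ}
    [∀ n, Module.Projective S (C.X n)] (a : C.X 0 →ₗ[S] S ⧸ I)
    (ha : ∀ p, a (dl C 0 p) = 0) :
    ∃ φ : C ⟶ R.complex, ∀ p, resAug R ((φ.f 0).hom p) = a p := by
  obtain ⟨g, hg⟩ := Module.projective_lifting_property (resAug R) a (resAug_surjective R)
  obtain ⟨φ, hφ, -⟩ := exists_hom_of_exactAlong (exactAlong_top R) g (fun p => by
    obtain ⟨z, hz⟩ := exists_dl_eq_of_resAug_eq_zero R (g (dl C 0 p))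
      ((LinearMap.congr_fun hg _).trans (ha p))
    exact ⟨z, trivial, hz⟩)
  exact ⟨φ, fun p => by rw [hφ]; exact LinearMap.congr_fun hg p⟩

theorem exists_homotopy_to_resolution {C : ChainComplex (ModuleCat.{u} S) ℕ}
    [∀ n, Module.Projective S (C.X n)] (φ ψ : C ⟶ R.complex)
    (h : ∀ p, resAug R ((φ.f 0).hom p) = resAug R ((ψ.f 0).hom p)) (n : ℕ) :
    ∃ h : C.X n →ₗ[S] R.complex.X (n + 1), ∀ p : C.X (n + 1),
      ∃ z, dl R.complex (n + 1) z =
        (φ.f (n + 1)).hom p - (ψ.f (n + 1)).hom p - h (dl C n p) := by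
  obtain ⟨k, hk⟩ := exists_homotopy_of_exactAlong (exactAlong_top R) (φ - ψ) (fun p => by
    obtain ⟨z, hz⟩ := exists_dl_eq_of_resAug_eq_zero R (((φ - ψ).f 0).hom p)
      (by simp [h p])
    exact ⟨z, trivial, hz⟩) (fun _ _ => trivial) n
  refine ⟨k, fun p => ?_⟩
  obtain ⟨z, -, hz⟩ := hk p
  exact ⟨z, hz⟩

/-- The homotopy seen by a cocycle `c`. -/
theorem cocycle_comp_sub {C : ChainComplex (ModuleCat.{u} S) ℕ}
    [∀ n, Module.Projective S (C.X n)] (φ ψ : C ⟶ R.complex)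
    (h : ∀ p, resAug R ((φ.f 0).hom p) = resAug R ((ψ.f 0).hom p)) (n : ℕ)
    {M : Type u} [AddCommGroup M] [Module S M] (c : R.complex.X (n + 1) →ₗ[S] M)
    (hc : ∀ z, c (dl R.complex (n + 1) z) = 0) :
    ∃ k : C.X n →ₗ[S] M, ∀ p : C.X (n + 1),
      c ((φ.f (n + 1)).hom p) = c ((ψ.f (n + 1)).hom p) + k (dl C n p) := by
  obtain ⟨k, hk⟩ := exists_homotopy_to_resolution R φ ψ h n
  refine ⟨c ∘ₗ k, fun p => ?_⟩
  obtain ⟨z, hz⟩ := hk p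
  have := hc z
  rw [hz, map_sub, map_sub, sub_sub, sub_eq_zero] at this
  exact this

/-! ### Extension classes of cocycles -/

variable {M : ModuleCat.{u} S} {n : ℕ}

/-- The class in `Ext^{n+1}(S/I, M)` of a cocycle on a projective resolution. -/
def cls (c : R.complex.X (n + 1) →ₗ[S] M) (hc : ∀ z, c (dl R.complex (n + 1) z) = 0) :
    Ext (cyc I) M (n + 1) :=
  R.extMk (ModuleCat.ofHom c) (n + 2) rfl (by ext z; exact hc z)

theorem cls_surjective (ξ : Ext (cyc I) M (n + 1)) : ∃ c hc, cls R (M := M) c hc = ξ := by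
  obtain ⟨f, hf, h⟩ := R.extMk_surjective ξ (n + 2) rfl
  exact ⟨f.hom, fun z => congrArg (fun g => g.hom z) hf, h⟩

theorem cls_eq_zero_iff (c : R.complex.X (n + 1) →ₗ[S] M)
    (hc : ∀ z, c (dl R.complex (n + 1) z) = 0) :
    cls R c hc = 0 ↔ ∃ k : R.complex.X n →ₗ[S] M, ∀ z, c z = k (dl R.complex n z) := by
  rw [cls, R.extMk_eq_zero_iff _ _ _ _ n rfl]
  constructor
  · rintro ⟨g, hg⟩
    exact ⟨g.hom, fun z => (congrArg (fun f => f.hom z) hg).symm⟩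
  · rintro ⟨k, hk⟩
    refine ⟨ModuleCat.ofHom k, ?_⟩
    ext z
    exact (hk z).symm

theorem cls_add (c c' : R.complex.X (n + 1) →ₗ[S] M)
    (hc : ∀ z, c (dl R.complex (n + 1) z) = 0) (hc' : ∀ z, c' (dl R.complex (n + 1) z) = 0) :
    cls R c hc + cls R c' hc' = cls R (c + c') (fun z => by simp [hc, hc']) :=
  R.add_extMk _ _ _ _ _ _

theorem cls_comp_mk₀ (c : R.complex.X (n + 1) →ₗ[S] M)
    (hc : ∀ z, c (dl R.complex (n + 1) z) = 0) {N : ModuleCat.{u} S} (g : M ⟶ N) :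
    (cls R c hc).comp (Ext.mk₀ g) (add_zero _) =
      cls R (M := N) (g.hom ∘ₗ c) (fun z => by simp [hc]) :=
  R.extMk_comp_mk₀ _ _ _ _ _

theorem smul_cls (s : S) (c : R.complex.X (n + 1) →ₗ[S] M)
    (hc : ∀ z, c (dl R.complex (n + 1) z) = 0) :
    s • cls R c hc = cls R (s • c) (fun z => by simp [hc]) := by
  rw [Ext.smul_eq_comp_mk₀, cls_comp_mk₀]
  rfl

theorem extMap_cls {R' : ProjectiveResolution (cyc J)} (f : cyc J ⟶ cyc I)
    (φ : R'.complex ⟶ R.complex)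
    (hφ : ∀ p, resAug R ((φ.f 0).hom p) = f.hom (resAug R' p))
    (c : R.complex.X (n + 1) →ₗ[S] M) (hc : ∀ z, c (dl R.complex (n + 1) z) = 0) :
    extMap f M (n + 1) (cls R c hc) = cls R' (c ∘ₗ (φ.f (n + 1)).hom) (fun z => by
      rw [LinearMap.comp_apply, ← comm_apply, hc]) := by
  let Φ : ProjectiveResolution.Hom R' R f :=
    { hom := φ
      hom_f_zero_comp_π_f_zero := by
        ext p
        exact hφ p }
  exact R.mk₀_comp_extMk (R' := R') (ModuleCat.ofHom c) _ _ _ Φ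

theorem extMap_comp {A B C : ModuleCat.{u} S} (f : A ⟶ B) (g : B ⟶ C) (N : ModuleCat.{u} S)
    (m : ℕ) (ξ : Ext C N m) : extMap f N m (extMap g N m ξ) = extMap (f ≫ g) N m ξ := by
  change (Ext.mk₀ f).comp ((Ext.mk₀ g).comp ξ (zero_add m)) (zero_add m) =
    (Ext.mk₀ (f ≫ g)).comp ξ (zero_add m)
  rw [Ext.mk₀_comp_mk₀_assoc]

theorem extMap_id {A : ModuleCat.{u} S} (N : ModuleCat.{u} S) (m : ℕ) (ξ : Ext A N m) :
    extMap (𝟙 A) N m ξ = ξ :=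
  Ext.mk₀_id_comp ξ

theorem extMap_smul {A B : ModuleCat.{u} S} (s : S) (f : A ⟶ B) (N : ModuleCat.{u} S) (m : ℕ)
    (ξ : Ext B N m) : extMap (s • f) N m ξ = s • extMap f N m ξ := by
  change (Ext.mk₀ (s • f)).comp ξ (zero_add m) = s • (Ext.mk₀ f).comp ξ (zero_add m)
  rw [Ext.mk₀_smul, Ext.smul_comp]

end Resolutions

/-! ### The Koszul complex -/

section Koszul

variable {d : ℕ} (y : Fin d → S)

theorem koszul_dl (n : ℕ) (z : (koszulComplex y).X (n + 1)) :
    dl (koszulComplex y) n z = koszulD y n z := by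
  have h : (koszulComplex y).d (n + 1) n = ModuleCat.ofHom (koszulD y n) :=
    ChainComplex.of_d (fun n => ModuleCat.of S (⋀[S]^n (Fin d → S)))
      (fun n => ModuleCat.ofHom (koszulD y n)) n
  exact congrArg (fun f => f.hom z) h

instance (n : ℕ) : Module.Free S ((koszulComplex y).X n) :=
  inferInstanceAs (Module.Free S (⋀[S]^n (Fin d → S)))

instance (n : ℕ) : Module.Finite S ((koszulComplex y).X n) :=
  inferInstanceAs (Module.Finite S (⋀[S]^n (Fin d → S)))

/-- The module `K_n` has a basis indexed by the `n`-element subsets of `Fin d`. -/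
theorem koszul_subsingleton {n : ℕ} (h : d < n) : Subsingleton ((koszulComplex y).X n) := by
  have : IsEmpty (Set.powersetCard (Fin d) n) := ⟨fun s => by
    have h1 := s.2
    have h2 := Finset.card_le_univ (s : Finset (Fin d))
    simp only [Set.powersetCard.card_eq, Fintype.card_fin] at h2
    omega⟩
  exact (((Pi.basisFun S (Fin d)).exteriorPower n).repr.toEquiv).subsingleton

/-- The coordinate `K_d(y; S) ≅ S`. -/
def topCoord : (koszulComplex y).X d →ₗ[S] S :=
  exteriorPower.alternatingMapLinearEquiv (Pi.basisFun S (Fin d)).det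

theorem topCoord_top : topCoord y (koszulTop y) = 1 := by
  refine (exteriorPower.alternatingMapLinearEquiv_apply_ιMulti _ _).trans ?_
  convert (Pi.basisFun S (Fin d)).det_self
  simp

/-- Alternating maps in `d` variables on `S^d` are determined by their values on permutations of the
standard basis, hence by a single value. -/
theorem topCoord_smul_top (z : (koszulComplex y).X d) : topCoord y z • koszulTop y = z := by
  have h : (LinearMap.toSpanSingleton S (⋀[S]^d (Fin d → S)) (koszulTop y)) ∘ₗ topCoord y =
      LinearMap.id (M := ⋀[S]^d (Fin d → S)) := by
    apply exteriorPower.linearMap_ext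
    refine (Pi.basisFun S (Fin d)).ext_alternating fun v hv => ?_
    obtain ⟨σ, rfl⟩ : ∃ σ : Equiv.Perm (Fin d), v = σ :=
      ⟨Equiv.ofBijective v (Finite.injective_iff_bijective.1 hv), rfl⟩
    have hb : (fun i => Pi.basisFun S (Fin d) (σ i)) =
        (fun i : Fin d => Pi.single i (1 : S)) ∘ σ := by
      ext1 i
      simp
    rw [hb, AlternatingMap.map_perm, AlternatingMap.map_perm]
    congr 1
    change topCoord y (koszulTop y) • koszulTop y = koszulTop y
    rw [topCoord_top, one_smul]
  exact LinearMap.congr_fun h z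

/-- The isomorphism `K_0(y; S) ≅ S`. -/
def koszulZero : (koszulComplex y).X 0 ≃ₗ[S] S :=
  exteriorPower.zeroEquiv S (Fin d → S)

theorem koszulZero_bot (r : S) : koszulZero y (koszulBot y r) = r := by
  refine (map_smul (exteriorPower.zeroEquiv S (Fin d → S)) r _).trans ?_
  rw [exteriorPower.zeroEquiv_ιMulti, smul_eq_mul, mul_one]

theorem koszulBot_koszulZero (z : (koszulComplex y).X 0) : koszulBot y (koszulZero y z) = z :=
  (koszulZero y).injective (koszulZero_bot y _)

/-- The differential is linear in the sequence `y`, so it is the combination with coefficients `y i`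
of the differentials of the coordinate sequences. -/
theorem koszulD_mem (n : ℕ) (z : ⋀[S]^(n + 1) (Fin d → S)) :
    koszulD y n z ∈ Ideal.span (Set.range y) • (⊤ : Submodule S (⋀[S]^n (Fin d → S))) := by
  have h : koszulD y n z = ∑ i, y i • koszulD (Pi.single i 1) n z := by
    apply Subtype.ext
    have hf : koszulForm y = ∑ i, y i • koszulForm (Pi.single i (1 : S)) := by
      apply LinearMap.pi_ext'
      intro j
      ext
      simp [koszulForm, Fintype.linearCombination_apply, Pi.single_apply]
    simp [koszulD, hf]
  rw [h]
  exact Submodule.sum_mem _ fun i _ =>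
    Submodule.smul_mem_smul (Ideal.subset_span ⟨i, rfl⟩) trivial

theorem dl_koszul_mem (n : ℕ) (z : (koszulComplex y).X (n + 1)) :
    dl (koszulComplex y) n z ∈
      Ideal.span (Set.range y) • (⊤ : Submodule S ((koszulComplex y).X n)) := by
  rw [koszul_dl]
  exact koszulD_mem y n z

/-- Exterior multiplication by the basis vector `e_i`. -/
def wedge (i : Fin d) (n : ℕ) : ⋀[S]^n (Fin d → S) →ₗ[S] ⋀[S]^(n + 1) (Fin d → S) :=
  (LinearMap.mulLeft S (ExteriorAlgebra.ι S (Pi.single i (1 : S)))).restrict fun z hz => by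
    rw [ExteriorAlgebra.exteriorPower, pow_succ']
    exact Submodule.mul_mem_mul ⟨_, rfl⟩ hz

theorem koszulForm_single (i : Fin d) : koszulForm y (Pi.single i 1) = y i := by
  simp [koszulForm, Fintype.linearCombination_apply, Pi.single_apply]

theorem contractLeft_ι_single_mul (i : Fin d) (b : ExteriorAlgebra S (Fin d → S)) :
    CliffordAlgebra.contractLeft (Q := (0 : QuadraticForm S (Fin d → S))) (koszulForm y)
      (ExteriorAlgebra.ι S (Pi.single i (1 : S)) * b) =
      y i • b - ExteriorAlgebra.ι S (Pi.single i (1 : S)) *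
        CliffordAlgebra.contractLeft (Q := (0 : QuadraticForm S (Fin d → S))) (koszulForm y) b := by
  rw [← koszulForm_single y i]
  exact CliffordAlgebra.contractLeft_ι_mul (Q := (0 : QuadraticForm S (Fin d → S))) _ _ b

/-- Wedging with `e_i` is a homotopy from multiplication by `y i` to zero, so `(y)` annihilates
Koszul homology. -/
theorem koszulD_wedge_succ (i : Fin d) (n : ℕ) (b : ⋀[S]^(n + 1) (Fin d → S)) :
    koszulD y (n + 1) (wedge i (n + 1) b) = y i • b - wedge i n (koszulD y n b) :=
  Subtype.ext (contractLeft_ι_single_mul y i b.1)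

theorem koszulD_wedge_zero (i : Fin d) (b : ⋀[S]^0 (Fin d → S)) :
    koszulD y 0 (wedge i 0 b) = y i • b := by
  apply Subtype.ext
  refine (contractLeft_ι_single_mul y i b.1).trans ?_
  obtain ⟨r, hr⟩ : ∃ r, algebraMap S _ r = b.1 := by
    have : b.1 ∈ LinearMap.range (ExteriorAlgebra.ι S (M := Fin d → S)) ^ 0 := b.2
    rwa [pow_zero, Submodule.mem_one] at this
  have h0 : CliffordAlgebra.contractLeft (Q := (0 : QuadraticForm S (Fin d → S))) (koszulForm y)
      b.1 = 0 := by
    rw [← hr]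
    exact CliffordAlgebra.contractLeft_algebraMap _ _ r
  rw [h0, mul_zero, sub_zero]
  rfl

/-- A linear map on the top Koszul module is a coboundary as soon as its value at the generator
lies in `(y) M`. -/
theorem exists_comp_dl_eq {n : ℕ} (y : Fin (n + 1) → S) {M : Type u} [AddCommGroup M] [Module S M]
    (u : (koszulComplex y).X (n + 1) →ₗ[S] M)
    (hu : u (koszulTop y) ∈ Ideal.span (Set.range y) • (⊤ : Submodule S M)) :
    ∃ h : (koszulComplex y).X n →ₗ[S] M, ∀ z, u z = h (dl (koszulComplex y) n z) := by
  -- The elements `m` for which the map with value `m` at the generator is a coboundary form a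
  -- submodule, so it suffices to treat `m ∈ y_i M`.
  let N : Submodule S M :=
    { carrier := {m | ∃ h : (koszulComplex y).X n →ₗ[S] M,
        ∀ z, topCoord y z • m = h (dl (koszulComplex y) n z)}
      add_mem' := by
        rintro a b ⟨h, hh⟩ ⟨k, hk⟩
        exact ⟨h + k, fun z => by rw [smul_add, hh, hk]; rfl⟩
      zero_mem' := ⟨0, fun z => by rw [smul_zero]; rfl⟩
      smul_mem' := by
        rintro r a ⟨h, hh⟩
        exact ⟨r • h, fun z => by rw [smul_comm, hh]; rfl⟩ }
  have hN : Ideal.span (Set.range y) • (⊤ : Submodule S M) ≤ N := by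
    rw [Submodule.smul_le]
    intro r hr m _
    induction hr using Submodule.span_induction with
    | mem x hx =>
      obtain ⟨i, rfl⟩ := hx
      -- Since `e_i ∧ z` lies in `K_{d+1} = 0`, the homotopy formula reads `e_i ∧ ∂z = y_i z`.
      refine ⟨LinearMap.toSpanSingleton S M m ∘ₗ topCoord y ∘ₗ wedge i n, fun z => ?_⟩
      have e := koszulD_wedge_succ y i n z
      have : wedge i (n + 1) z = 0 :=
        (koszul_subsingleton y (Nat.lt_succ_self (n + 1))).elim _ _
      rw [this, map_zero, eq_comm, sub_eq_zero] at e
      have e' : topCoord y (wedge i n (koszulD y n z)) = y i • topCoord y z :=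
        (congrArg (topCoord y) e.symm).trans (map_smul (topCoord y) (y i) z)
      change _ = topCoord y (wedge i n (dl (koszulComplex y) n z)) • m
      rw [koszul_dl, e', smul_smul, smul_eq_mul, mul_comm]
    | zero => rw [zero_smul]; exact N.zero_mem
    | add a b _ _ ha hb => rw [add_smul]; exact N.add_mem ha hb
    | smul a b _ hb => rw [smul_assoc]; exact N.smul_mem _ hb
  obtain ⟨h, hh⟩ := hN hu
  refine ⟨h, fun z => ?_⟩
  rw [← hh, ← map_smul, topCoord_smul_top]

end Koszul

/-! ### Diagonal scaling between Koszul complexes -/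

section Scale

variable {d : ℕ}

/-- Naturality of contraction, checked on generators of the exterior algebra. It makes the diagonal
scaling of Koszul complexes a chain map. -/
theorem contractLeft_map {M N : Type u} [AddCommGroup M] [Module S M] [AddCommGroup N] [Module S N]
    (D : M →ₗ[S] N) (f : Module.Dual S N) (z : ExteriorAlgebra S M) :
    CliffordAlgebra.contractLeft (Q := (0 : QuadraticForm S N)) f (ExteriorAlgebra.map D z) =
      ExteriorAlgebra.map D
        (CliffordAlgebra.contractLeft (Q := (0 : QuadraticForm S M)) (f ∘ₗ D) z) := by
  induction z using CliffordAlgebra.left_induction (Q := (0 : QuadraticForm S M)) with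
  | algebraMap r =>
    have h : ExteriorAlgebra.map D (algebraMap S (ExteriorAlgebra S M) r) =
      algebraMap S (ExteriorAlgebra S N) r := AlgHom.commutes _ r
    erw [h, CliffordAlgebra.contractLeft_algebraMap, CliffordAlgebra.contractLeft_algebraMap,
      map_zero]
  | add a b ha hb =>
    rw [map_add, map_add, map_add, map_add, ha, hb]
  | ι_mul z m hz =>
    have h1 : ExteriorAlgebra.map D (CliffordAlgebra.ι (0 : QuadraticForm S M) m * z) =
        CliffordAlgebra.ι (0 : QuadraticForm S N) (D m) * ExteriorAlgebra.map D z :=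
      (map_mul (ExteriorAlgebra.map D) _ z).trans
        (congrArg (· * _) (ExteriorAlgebra.map_apply_ι D m))
    rw [h1, CliffordAlgebra.contractLeft_ι_mul, CliffordAlgebra.contractLeft_ι_mul, hz, map_sub,
      map_smul]
    congr 1
    exact ((map_mul (ExteriorAlgebra.map D) _ _).trans
        (congrArg (· * _) (ExteriorAlgebra.map_apply_ι D m))).symm

theorem coe_exteriorPower_map {M N : Type u} [AddCommGroup M] [Module S M] [AddCommGroup N]
    [Module S N] (D : M →ₗ[S] N) (n : ℕ) (z : ⋀[S]^n M) :
    (exteriorPower.map n D z : ExteriorAlgebra S N) = ExteriorAlgebra.map D z := by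
  have h : (⋀[S]^n N).subtype ∘ₗ exteriorPower.map n D =
      (ExteriorAlgebra.map D).toLinearMap ∘ₗ (⋀[S]^n M).subtype := by
    apply exteriorPower.linearMap_ext
    ext m
    simp [ExteriorAlgebra.map_apply_ιMulti]
  exact LinearMap.congr_fun h z

variable {a y y' : Fin d → S}

theorem koszulD_map (h : ∀ i, y' i = a i * y i) (n : ℕ) (z : ⋀[S]^(n + 1) (Fin d → S)) :
    koszulD y n (exteriorPower.map (n + 1) (LinearMap.mulLeft S a) z) =
      exteriorPower.map n (LinearMap.mulLeft S a) (koszulD y' n z) := by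
  have hf : koszulForm y ∘ₗ LinearMap.mulLeft S a = koszulForm y' := by
    ext i
    simp [koszulForm, Fintype.linearCombination_apply, Pi.single_apply, h]
  apply Subtype.ext
  rw [coe_exteriorPower_map]
  refine (congrArg (CliffordAlgebra.contractLeft (Q := (0 : QuadraticForm S (Fin d → S)))
    (koszulForm y)) (coe_exteriorPower_map _ _ z)).trans ?_
  rw [contractLeft_map, hf]
  rfl

/-- The chain map `K(a_1 y_1, …, a_d y_d) → K(y_1, …, y_d)`, `e_i ↦ a_i e_i`. -/
def koszulScale (h : ∀ i, y' i = a i * y i) : koszulComplex y' ⟶ koszulComplex y :=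
  homOfComm (C := koszulComplex y') (D := koszulComplex y)
    (fun n => exteriorPower.map n (LinearMap.mulLeft S a)) fun n z =>
      ((koszul_dl y n _).trans (koszulD_map h n z)).trans
        (congrArg (exteriorPower.map n (LinearMap.mulLeft S a)) (koszul_dl y' n z).symm)

theorem koszulScale_top (h : ∀ i, y' i = a i * y i) :
    ((koszulScale h).f d).hom (koszulTop y') = (∏ i, a i) • koszulTop y := by
  refine (exteriorPower.map_apply_ιMulti _ _).trans ?_
  have : (LinearMap.mulLeft S a ∘ fun i : Fin d => Pi.single i (1 : S)) =
      fun i => a i • (Pi.single i (1 : S) : Fin d → S) := by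
    ext i j
    by_cases hij : j = i
    · subst hij; simp
    · simp [hij]
  rw [this, AlternatingMap.map_smul_univ]
  rfl

theorem koszulScale_bot (h : ∀ i, y' i = a i * y i) (r : S) :
    ((koszulScale h).f 0).hom (koszulBot y' r) = koszulBot y r := by
  refine (map_smul (exteriorPower.map 0 (LinearMap.mulLeft S a)) r _).trans ?_
  rw [exteriorPower.map_apply_ιMulti]
  unfold koszulBot
  congr 2
  ext i
  exact i.elim0

theorem alternatingMap_update_mem {ι M N : Type*} [DecidableEq ι] [AddCommGroup M] [Module S M]
    [AddCommGroup N] [Module S N] (F : M [⋀^ι]→ₗ[S] N) (m : ι → M) (i : ι) {b : Ideal S} {x : M}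
    (hx : x ∈ b • (⊤ : Submodule S M)) :
    F (Function.update m i x) ∈ b • (⊤ : Submodule S N) := by
  have := Submodule.mem_map_of_mem (f := F.toMultilinearMap.toLinearMap m i) hx
  rw [Submodule.map_smul''] at this
  exact Submodule.smul_mono le_rfl le_top this

/-- In positive degree a wedge has at least one factor, and scaling that factor alone already puts
the wedge into `b` times the module. -/
theorem exteriorPower_map_mulLeft_mem {b : Ideal S} (hb : ∀ i, a i ∈ b) (n : ℕ)
    (z : ⋀[S]^(n + 1) (Fin d → S)) :
    exteriorPower.map (n + 1) (LinearMap.mulLeft S a) z ∈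
      b • (⊤ : Submodule S (⋀[S]^(n + 1) (Fin d → S))) := by
  have hz : z ∈ Submodule.span S (Set.range (exteriorPower.ιMulti S (n + 1) (M := Fin d → S))) := by
    rw [exteriorPower.ιMulti_span]
    exact Submodule.mem_top
  have hle : Submodule.span S (Set.range (exteriorPower.ιMulti S (n + 1) (M := Fin d → S))) ≤
      (b • (⊤ : Submodule S (⋀[S]^(n + 1) (Fin d → S)))).comap
        (exteriorPower.map (n + 1) (LinearMap.mulLeft S a)) := by
    rw [Submodule.span_le]
    rintro _ ⟨m, rfl⟩
    rw [SetLike.mem_coe, Submodule.mem_comap, exteriorPower.map_apply_ιMulti]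
    have hm : a * m 0 ∈ b • (⊤ : Submodule S (Fin d → S)) := by
      have : a * m 0 = ∑ i, a i • Pi.single i (m 0 i) := by
        ext j
        simp [Finset.sum_apply, Pi.single_apply]
      rw [this]
      exact Submodule.sum_mem _ fun i _ => Submodule.smul_mem_smul (hb i) trivial
    have hu : LinearMap.mulLeft S a ∘ m =
        Function.update (LinearMap.mulLeft S a ∘ m) 0 (a * m 0) :=
      (Function.update_eq_self 0 _).symm
    rw [hu]
    exact alternatingMap_update_mem _ _ 0 hm
  exact hle hz

theorem koszulScale_mem (h : ∀ i, y' i = a i * y i) {b : Ideal S} (hb : ∀ i, a i ∈ b) (n : ℕ)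
    (z : (koszulComplex y').X (n + 1)) :
    ((koszulScale h).f (n + 1)).hom z ∈ b • (⊤ : Submodule S ((koszulComplex y).X (n + 1))) :=
  exteriorPower_map_mulLeft_mem hb n z

end Scale

/-! ### Artin–Rees for the Koszul complex -/

section ArtinRees

/-- If `𝔞 Z` consists of boundaries, then so does `Z ∩ 𝔞^{t+s} M`, and with primitives in
`𝔞^t L`, for some `s` independent of `t`. -/
theorem exists_pow_inf_le_map [IsNoetherianRing S] {L M : Type u} [AddCommGroup L] [Module S L]
    [AddCommGroup M] [Module S M] [Module.Finite S M] (g : L →ₗ[S] M) (Z : Submodule S M)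
    (I : Ideal S) (hZ : I • Z ≤ LinearMap.range g) :
    ∃ s : ℕ, ∀ t : ℕ, (I ^ (t + s) • ⊤ : Submodule S M) ⊓ Z ≤ (I ^ t • ⊤ : Submodule S L).map g := by
  obtain ⟨k, hk⟩ := I.exists_pow_inf_eq_pow_smul Z
  -- With `k` the Artin–Rees constant, `I^{t+k+1} M ∩ Z = I^{t+1} (I^k M ∩ Z) ⊆ I^t (I Z)`; the
  -- extra factor `I` turns elements of `Z` into boundaries.
  refine ⟨k + 1, fun t => ?_⟩
  rw [hk (t + (k + 1)) (by omega), show t + (k + 1) - k = t + 1 by omega, pow_succ,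
    Submodule.map_smul'', Submodule.map_top, Submodule.mul_smul]
  exact Submodule.smul_mono le_rfl ((Submodule.smul_mono le_rfl inf_le_right).trans hZ)

variable {d : ℕ} (y : Fin d → S)

theorem koszul_smul_le_range (n : ℕ) (Z : Submodule S ((koszulComplex y).X n))
    (hZ : ∀ i, ∀ z ∈ Z, y i • z ∈ LinearMap.range (dl (koszulComplex y) n)) :
    Ideal.span (Set.range y) • Z ≤ LinearMap.range (dl (koszulComplex y) n) := by
  rw [Submodule.smul_le]
  intro r hr z hz
  induction hr using Submodule.span_induction with
  | mem x hx =>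
    obtain ⟨i, rfl⟩ := hx
    exact hZ i z hz
  | zero => rw [zero_smul]; exact Submodule.zero_mem _
  | add a b _ _ ha hb => rw [add_smul]; exact Submodule.add_mem _ ha hb
  | smul a b _ hb => rw [smul_assoc]; exact Submodule.smul_mem _ _ hb

/-- Elements of a high power of `(y)` times the Koszul complex form an exact system. -/
theorem exists_exactAlong_koszul [IsNoetherianRing S] : ∃ (N : ℕ) (A : ∀ n, Submodule S ((koszulComplex y).X n)),
    (∀ n, Ideal.span (Set.range y) ^ N • ⊤ ≤ A n) ∧ ExactAlong A ∧
      ∀ z ∈ Ideal.span (Set.range y) ^ N • (⊤ : Submodule S ((koszulComplex y).X 0)),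
        ∃ z' ∈ A 1, dl (koszulComplex y) 0 z' = z := by
  set I := Ideal.span (Set.range y)
  have h0 := exists_pow_inf_le_map (dl (koszulComplex y) 0) ⊤ I
    (koszul_smul_le_range y 0 ⊤ fun i z _ => ⟨wedge i 0 z,
      (koszul_dl y 0 _).trans (koszulD_wedge_zero y i z)⟩)
  have hn : ∀ n, ∃ s : ℕ, ∀ t : ℕ,
      (I ^ (t + s) • ⊤ : Submodule S ((koszulComplex y).X (n + 1))) ⊓
        LinearMap.ker (dl (koszulComplex y) n) ≤
      (I ^ t • ⊤ : Submodule S ((koszulComplex y).X (n + 2))).map (dl (koszulComplex y) (n + 1)) :=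
    fun n => exists_pow_inf_le_map _ _ I
      (koszul_smul_le_range y (n + 1) _ fun i z hz => ⟨wedge i (n + 1) z, by
        rw [LinearMap.mem_ker, koszul_dl] at hz
        refine ((koszul_dl y (n + 1) _).trans (koszulD_wedge_succ y i n z)).trans ?_
        have : wedge i n (koszulD y n z) = 0 :=
          (congrArg (wedge i n) hz).trans (map_zero (wedge i n))
        rw [this, sub_zero]
        rfl⟩)
  obtain ⟨s₀, h0⟩ := h0
  choose s hs using hn
  -- Each lifting step loses `s n` powers of `I`. Since `K` stops in degree `d`, a finite budget
  -- suffices, and `t n` is what must remain from step `n` on.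
  let t : ℕ → ℕ := fun n => ∑ j ∈ Finset.Ico n d, s j
  have ht : ∀ n, n < d → t n = t (n + 1) + s n := fun n h => by
    change ∑ j ∈ Finset.Ico n d, s j = _
    rw [Finset.sum_eq_sum_Ico_succ_bot h, add_comm]
  have htm : ∀ n, t n ≤ t 0 := fun n =>
    Finset.sum_le_sum_of_subset (Finset.Ico_subset_Ico_left (Nat.zero_le n))
  -- Step `n` goes from `A (n + 1)` to `A (n + 2)`, whence the shift. The truncated value at `n = 0`
  -- plays no part in exactness, which concerns positive degrees.
  refine ⟨t 0 + s₀, fun n => I ^ (t (n - 1)) • ⊤, fun n => ?_, fun n z hz hz' => ?_,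
    fun z hz => ?_⟩
  · exact Submodule.smul_mono_left (Ideal.pow_le_pow_right ((htm _).trans (Nat.le_add_right _ _)))
  · rcases lt_or_ge n d with h | h
    · simp only [Nat.add_sub_cancel] at hz
      rw [ht n h] at hz
      exact hs n _ ⟨hz, hz'⟩
    · have := koszul_subsingleton y (Nat.lt_succ_of_le h)
      exact ⟨0, Submodule.zero_mem _, this.elim _ _⟩
  · exact h0 _ ⟨hz, trivial⟩

end ArtinRees

/-! ### Comparing Koszul complexes and resolutions -/

section Compare

variable {d : ℕ} {y : Fin d → S} {I J : Ideal S}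

/-- The chain map `φ : K(y) → R` induces multiplication by `s` on `0`-th homologies. -/
def LiftsScalar (R : ProjectiveResolution (cyc I)) (φ : koszulComplex y ⟶ R.complex)
    (s : S) : Prop :=
  ∀ z, resAug R ((φ.f 0).hom z) = Ideal.Quotient.mk I (s * koszulZero y z)

theorem liftsMul_iff {G : FreeResolution I} (φ : koszulComplex y ⟶ G.res.complex) (s : S) :
    LiftsMul φ s ↔ LiftsScalar G.res φ s := by
  constructor
  · intro h z
    have := h (koszulZero y z)
    rw [koszulBot_koszulZero] at this
    exact this
  · intro h r
    have := h (koszulBot y r)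
    rw [koszulZero_bot] at this
    exact this

theorem koszulZero_mem {b : Ideal S} {z : (koszulComplex y).X 0}
    (hz : z ∈ b • (⊤ : Submodule S ((koszulComplex y).X 0))) : koszulZero y z ∈ b := by
  have := Submodule.mem_map_of_mem (f := (koszulZero y).toLinearMap) hz
  rw [Submodule.map_smul''] at this
  have h2 := Submodule.smul_mono (le_refl b) (le_top (a := (⊤ : Submodule S
    ((koszulComplex y).X 0)).map (koszulZero y).toLinearMap)) this
  rwa [smul_eq_mul, Ideal.mul_top] at h2

theorem mem_of_koszulZero_mem {b : Ideal S} {z : (koszulComplex y).X 0}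
    (hz : koszulZero y z ∈ b) : z ∈ b • (⊤ : Submodule S ((koszulComplex y).X 0)) := by
  have : z = koszulZero y z • (koszulZero y).symm 1 := by
    rw [← map_smul, smul_eq_mul, mul_one, LinearEquiv.symm_apply_apply]
  rw [this]
  exact Submodule.smul_mem_smul hz trivial

theorem exists_liftsScalar (R : ProjectiveResolution (cyc I)) (s : S) (h : ∀ i, s * y i ∈ I) :
    ∃ φ : koszulComplex y ⟶ R.complex, LiftsScalar R φ s := by
  have hI : ∀ r ∈ Ideal.span (Set.range y), s * r ∈ I := fun r hr => by
    have : Ideal.span (Set.range y) ≤ Submodule.comap (LinearMap.mulLeft S s) I := by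
      rw [Ideal.span, Submodule.span_le]
      rintro _ ⟨i, rfl⟩
      exact h i
    exact this hr
  obtain ⟨φ, hφ⟩ := exists_hom_to_resolution R (C := koszulComplex y)
    (I.mkQ ∘ₗ (s • (koszulZero y).toLinearMap))
    (fun p => (Submodule.Quotient.mk_eq_zero _).2 (hI _ (koszulZero_mem (dl_koszul_mem y 0 p))))
  exact ⟨φ, hφ⟩

/-- Over a Noetherian ring, resolutions of `S/J` for `J` inside a high power of `(y)` map to the
Koszul complex of `y`. -/
theorem exists_hom_to_koszul [IsNoetherianRing S] (y : Fin d → S) :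
    ∃ N : ℕ, ∀ J ≤ Ideal.span (Set.range y) ^ N, ∀ R : ProjectiveResolution (cyc J),
      ∃ f : R.complex ⟶ koszulComplex y,
        ∀ p, Ideal.Quotient.mk J (koszulZero y ((f.f 0).hom p)) = resAug R p := by
  obtain ⟨N, A, -, hA, hA₀⟩ := exists_exactAlong_koszul y
  refine ⟨N, fun J hJ R => ?_⟩
  obtain ⟨l, hl⟩ := Module.projective_lifting_property J.mkQ (resAug R) J.mkQ_surjective
  have hl' : ∀ p, Ideal.Quotient.mk J (l p) = resAug R p := fun p => LinearMap.congr_fun hl p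
  obtain ⟨f, hf, -⟩ := exists_hom_of_exactAlong hA ((koszulZero y).symm.toLinearMap ∘ₗ l)
    (fun p => hA₀ _ (mem_of_koszulZero_mem (hJ (by
      refine Ideal.Quotient.eq_zero_iff_mem.1 ?_
      rw [LinearMap.comp_apply, LinearEquiv.coe_coe, LinearEquiv.apply_symm_apply, hl',
        resAug_dl]))))
  refine ⟨f, fun p => ?_⟩
  rw [hf, LinearMap.comp_apply, LinearEquiv.coe_coe, LinearEquiv.apply_symm_apply, hl']

theorem exists_hom_over (R' : ProjectiveResolution (cyc J)) (R : ProjectiveResolution (cyc I))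
    (f : cyc J ⟶ cyc I) :
    ∃ θ : R'.complex ⟶ R.complex, ∀ p, resAug R ((θ.f 0).hom p) = f.hom (resAug R' p) :=
  exists_hom_to_resolution R (f.hom ∘ₗ resAug R') fun p => by
    rw [LinearMap.comp_apply, resAug_dl, map_zero]

theorem cycMap_mk (h : J ≤ I) (r : S) :
    (cycMap h).hom (Ideal.Quotient.mk J r) = Ideal.Quotient.mk I r := rfl

theorem smul_hom_apply {C D : ChainComplex (ModuleCat.{u} S) ℕ} (s : S) (θ : C ⟶ D) (n : ℕ)
    (p : C.X n) : ((s • θ).f n).hom p = s • (θ.f n).hom p := rfl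

theorem comp_hom_apply {C D E : ChainComplex (ModuleCat.{u} S) ℕ} (θ : C ⟶ D) (η : D ⟶ E) (n : ℕ)
    (p : C.X n) : ((θ ≫ η).f n).hom p = (η.f n).hom ((θ.f n).hom p) := rfl

variable {n : ℕ} {M : ModuleCat.{u} S}

/-- If the value `c(φ_d(1))` of a cocycle lies in `(y) M`, then `s` times its class dies over
`S/J` for all sufficiently small `J`. -/
theorem exists_smul_extMap_eq_zero [IsNoetherianRing S] {y : Fin (n + 1) → S}
    (R : ProjectiveResolution (cyc I)) (φ : koszulComplex y ⟶ R.complex) {s : S}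
    (hφ : LiftsScalar R φ s) (c : R.complex.X (n + 1) →ₗ[S] M)
    (hc : ∀ z, c (dl R.complex (n + 1) z) = 0)
    (h : c ((φ.f (n + 1)).hom (koszulTop y)) ∈ Ideal.span (Set.range y) • (⊤ : Submodule S M)) :
    ∃ N : ℕ, ∀ J ≤ Ideal.span (Set.range y) ^ N, ∀ hJ : J ≤ I,
      s • extMap (cycMap hJ) M (n + 1) (cls R c hc) = 0 := by
  obtain ⟨N, hN⟩ := exists_hom_to_koszul y
  refine ⟨N, fun J hJN hJ => ?_⟩
  let R' := projectiveResolution (cyc J)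
  obtain ⟨f, hf⟩ := hN J hJN R'
  obtain ⟨θ, hθ⟩ := exists_hom_over R' R (cycMap hJ)
  -- Both `s • θ` and the map through the Koszul complex lift `s` times the projection `S/J → S/I`.
  -- On the second one `c` is a coboundary by `h`.
  obtain ⟨k, hk⟩ := cocycle_comp_sub R (s • θ) (f ≫ φ) (fun p => by
    rw [smul_hom_apply, comp_hom_apply, map_smul, hθ, hφ, ← hf, cycMap_mk, map_mul]
    rfl) n c hc
  obtain ⟨u, hu⟩ := exists_comp_dl_eq y (c ∘ₗ (φ.f (n + 1)).hom) h
  rw [extMap_cls R (cycMap hJ) θ hθ, smul_cls, cls_eq_zero_iff]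
  refine ⟨u ∘ₗ (f.f n).hom + k, fun z => ?_⟩
  have h1 := hk z
  rw [smul_hom_apply, comp_hom_apply, map_smul] at h1
  rw [LinearMap.smul_apply, LinearMap.comp_apply, h1, LinearMap.add_apply, LinearMap.comp_apply,
    ← comm_apply, ← hu]
  rfl

theorem linearMap_mem_smul_top {M N : Type*} [AddCommGroup M] [Module S M] [AddCommGroup N]
    [Module S N] (f : M →ₗ[S] N) {b : Ideal S} {x : M} (hx : x ∈ b • (⊤ : Submodule S M)) :
    f x ∈ b • (⊤ : Submodule S N) := by
  have := Submodule.mem_map_of_mem (f := f) hx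
  rw [Submodule.map_smul''] at this
  exact Submodule.smul_mono le_rfl le_top this

/-- Two lifts of the same map have the same value at the generator, modulo `(y) M`. -/
theorem cocycle_top_sub_mem {y : Fin (n + 1) → S}
    (R : ProjectiveResolution (cyc I)) {φ ψ : koszulComplex y ⟶ R.complex}
    (h : ∀ z, resAug R ((φ.f 0).hom z) = resAug R ((ψ.f 0).hom z))
    (c : R.complex.X (n + 1) →ₗ[S] M) (hc : ∀ z, c (dl R.complex (n + 1) z) = 0) :
    c ((φ.f (n + 1)).hom (koszulTop y)) - c ((ψ.f (n + 1)).hom (koszulTop y)) ∈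
      Ideal.span (Set.range y) • (⊤ : Submodule S M) := by
  obtain ⟨k, hk⟩ := cocycle_comp_sub R φ ψ h n c hc
  rw [hk, add_sub_cancel_left]
  exact linearMap_mem_smul_top k (dl_koszul_mem y n _)

theorem koszulZero_koszulScale {a y y' : Fin d → S} (h : ∀ i, y' i = a i * y i)
    (z : (koszulComplex y').X 0) :
    koszulZero y (((koszulScale h).f 0).hom z) = koszulZero y' z := by
  conv_lhs => rw [← koszulBot_koszulZero y' z, koszulScale_bot, koszulZero_bot]

/-- If `s` times the class of a cocycle dies over `S/J` and `(a y) ⊆ J`, then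
`∏ a · c(φ_d(1))` lies in `(a y) M`. -/
theorem prod_smul_mem_of_smul_extMap_eq_zero {a y y' : Fin (n + 1) → S}
    (h : ∀ i, y' i = a i * y i) (R : ProjectiveResolution (cyc I))
    (φ : koszulComplex y ⟶ R.complex) {s : S} (hφ : LiftsScalar R φ s)
    (c : R.complex.X (n + 1) →ₗ[S] M) (hc : ∀ z, c (dl R.complex (n + 1) z) = 0) (hJ : J ≤ I)
    (h0 : s • extMap (cycMap hJ) M (n + 1) (cls R c hc) = 0) (hy' : ∀ i, y' i ∈ J) :
    (∏ i, a i) • c ((φ.f (n + 1)).hom (koszulTop y)) ∈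
      Ideal.span (Set.range y') • (⊤ : Submodule S M) := by
  let R' := projectiveResolution (cyc J)
  obtain ⟨θ, hθ⟩ := exists_hom_over R' R (cycMap hJ)
  obtain ⟨ψ, hψ⟩ := exists_liftsScalar (y := y') R' 1 (by simpa using hy')
  rw [extMap_cls R (cycMap hJ) θ hθ, smul_cls, cls_eq_zero_iff] at h0
  obtain ⟨k, hk⟩ := h0
  -- There are two routes from `K(y')` to `R` lifting multiplication by `s`: through `K(y)`, where
  -- the generator acquires the factor `∏ a`, and through `R'`, where `s • c` is a coboundary.
  have h1 := cocycle_top_sub_mem R (φ := koszulScale h ≫ φ) (ψ := s • (ψ ≫ θ)) (fun z => by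
    rw [comp_hom_apply, smul_hom_apply, comp_hom_apply, map_smul, hθ, hφ, hψ, cycMap_mk,
      koszulZero_koszulScale, one_mul, map_mul]
    rfl) c hc
  have h2 : c (((s • (ψ ≫ θ)).f (n + 1)).hom (koszulTop y')) ∈
      Ideal.span (Set.range y') • (⊤ : Submodule S M) := by
    have h3 := hk ((ψ.f (n + 1)).hom (koszulTop y'))
    rw [LinearMap.smul_apply, LinearMap.comp_apply] at h3
    rw [smul_hom_apply, comp_hom_apply, map_smul, h3, comm_apply]
    exact linearMap_mem_smul_top (k ∘ₗ (ψ.f n).hom) (dl_koszul_mem y' n _)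
  have h3 := Submodule.add_mem _ h1 h2
  rw [sub_add_cancel, comp_hom_apply, koszulScale_top, map_smul, map_smul] at h3
  exact h3

end Compare

/-! ### Vanishing in local cohomology -/

section LocalCohomology

variable {I J : Ideal S} {n : ℕ} {M : ModuleCat.{u} S}

theorem cycMap_comp {K : Ideal S} (h : K ≤ J) (h' : J ≤ I) :
    cycMap h ≫ cycMap h' = cycMap (h.trans h') := by
  refine ModuleCat.hom_ext (LinearMap.ext fun x => ?_)
  obtain ⟨r, rfl⟩ := Ideal.Quotient.mk_surjective x
  rfl

instance (I : Ideal S) (n : ℕ) (M : ModuleCat.{u} S) :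
    DirectedSystem (fun m : ℕ => Ext (cyc (I ^ m)) M n)
      (fun _ _ h => extMap (cycMap (Ideal.pow_le_pow_right h)) M n) where
  map_self m ξ := by
    have : cycMap (le_refl (I ^ m)) = 𝟙 _ := by
      refine ModuleCat.hom_ext (LinearMap.ext fun x => ?_)
      obtain ⟨r, rfl⟩ := Ideal.Quotient.mk_surjective x
      rfl
    change extMap (cycMap (le_refl (I ^ m))) M n ξ = ξ
    rw [this, extMap_id]
  map_map i j k hij hjk ξ := by
    rw [extMap_comp, cycMap_comp]

theorem exists_extMap_eq_zero_of_theta_eq_zero {ξ : Ext (cyc I) M n} (h : theta I n M ξ = 0) :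
    ∃ (m : ℕ) (_ : 1 ≤ m) (hm : I ^ m ≤ I), extMap (cycMap hm) M n ξ = 0 := by
  obtain ⟨m, hm, h⟩ := Module.DirectLimit.of.zero_exact h
  rw [extMap_comp, cycMap_comp] at h
  exact ⟨m, hm, _, h⟩

/-- Vanishing may be tested over any ideal that contains a power of `I`, because the powers are
cofinal below it. -/
theorem locCoh_of_eq_zero {m : ℕ} {ξ : Ext (cyc (I ^ m)) M n} (hJ : J ≤ I ^ m)
    (h : extMap (cycMap hJ) M n ξ = 0) {k : ℕ} (hk : I ^ k ≤ J) :
    Module.DirectLimit.of S ℕ (fun m : ℕ => Ext (cyc (I ^ m)) M n)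
      (fun _ _ h => extMap (cycMap (Ideal.pow_le_pow_right h)) M n) m ξ = 0 := by
  have hle : m ≤ max m k := le_max_left _ _
  have hkJ : I ^ max m k ≤ J := (Ideal.pow_le_pow_right (le_max_right _ _)).trans hk
  rw [← Module.DirectLimit.of_f (hij := hle)]
  have : extMap (cycMap (Ideal.pow_le_pow_right hle)) M n ξ = 0 := by
    rw [← cycMap_comp hkJ hJ, ← extMap_comp, h, map_zero]
  rw [this, map_zero]

theorem theta_eq_zero {ξ : Ext (cyc I) M n} (hJ : J ≤ I) (h : extMap (cycMap hJ) M n ξ = 0)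
    {k : ℕ} (hk : I ^ k ≤ J) : theta I n M ξ = 0 := by
  have key : ∀ (m : ℕ) (hm : I ^ m ≤ I) (hJm : J ≤ I ^ m),
      Module.DirectLimit.of S ℕ (fun m : ℕ => Ext (cyc (I ^ m)) M n)
        (fun _ _ h => extMap (cycMap (Ideal.pow_le_pow_right h)) M n) m
          (extMap (cycMap hm) M n ξ) = 0 := fun m hm hJm =>
    locCoh_of_eq_zero hJm (by rwa [extMap_comp, cycMap_comp]) hk
  rw [theta, LinearMap.comp_apply]
  exact key 1 (pow_one I).le (hJ.trans (pow_one I).ge)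

end LocalCohomology

/-! ### Existence of finite free resolutions over a Noetherian ring -/

section FiniteFree

variable (S) in
/-- A linear map between finite free modules. -/
structure FiniteFreeMap where
  /-- the rank of the target -/
  tgt : ℕ
  /-- the rank of the source -/
  src : ℕ
  /-- the map -/
  map : (Fin src → S) →ₗ[S] (Fin tgt → S)

theorem exists_range_eq [IsNoetherianRing S] {M : Type u} [AddCommGroup M] [Module S M]
    [Module.Finite S M] (N : Submodule S M) :
    ∃ (m : ℕ) (g : (Fin m → S) →ₗ[S] M), LinearMap.range g = N := by
  obtain ⟨m, g, hg⟩ := Module.Finite.exists_fin' S N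
  refine ⟨m, N.subtype ∘ₗ g, ?_⟩
  rw [LinearMap.range_comp, LinearMap.range_eq_top.2 hg, Submodule.map_top,
    Submodule.range_subtype]

/-- The next step of a finite free resolution. -/
def FiniteFreeMap.next [IsNoetherianRing S] (s : FiniteFreeMap S) : FiniteFreeMap S where
  tgt := s.src
  src := (exists_range_eq (LinearMap.ker s.map)).choose
  map := (exists_range_eq (LinearMap.ker s.map)).choose_spec.choose

theorem FiniteFreeMap.range_next [IsNoetherianRing S] (s : FiniteFreeMap S) :
    LinearMap.range s.next.map = LinearMap.ker s.map :=
  (exists_range_eq (LinearMap.ker s.map)).choose_spec.choose_spec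

/-- Iterated kernels. -/
def FiniteFreeMap.iter [IsNoetherianRing S] (s : FiniteFreeMap S) : ℕ → FiniteFreeMap S
  | 0 => s
  | n + 1 => (s.iter n).next

/-- The chain complex of finite free modules that begins with a given map. -/
def FiniteFreeMap.complex [IsNoetherianRing S] (s : FiniteFreeMap S) :
    ChainComplex (ModuleCat.{u} S) ℕ :=
  ChainComplex.of (fun n => ModuleCat.of S (Fin (s.iter n).tgt → S))
    (fun n => ModuleCat.ofHom (s.iter n).map)
    (fun n => by
      ext1
      refine LinearMap.ext fun z => ?_
      have : (s.iter n).next.map z ∈ LinearMap.ker (s.iter n).map := by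
        rw [← FiniteFreeMap.range_next]
        exact ⟨z, rfl⟩
      exact this)

theorem FiniteFreeMap.complex_d [IsNoetherianRing S] (s : FiniteFreeMap S) (n : ℕ) :
    s.complex.d (n + 1) n = ModuleCat.ofHom (s.iter n).map :=
  ChainComplex.of_d (fun n => ModuleCat.of S (Fin (s.iter n).tgt → S))
    (fun n => ModuleCat.ofHom (s.iter n).map) n

theorem FiniteFreeMap.complex_exactAt [IsNoetherianRing S] (s : FiniteFreeMap S) (n : ℕ) :
    s.complex.ExactAt (n + 1) := by
  rw [HomologicalComplex.exactAt_iff' _ (n + 1 + 1) (n + 1) n (by simp) (by simp),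
    ShortComplex.moduleCat_exact_iff]
  intro z hz
  change (s.complex.d (n + 1) n).hom z = 0 at hz
  change ∃ z', (s.complex.d (n + 2) (n + 1)).hom z' = z
  rw [FiniteFreeMap.complex_d] at hz ⊢
  have : z ∈ LinearMap.range (s.iter n).next.map := by
    rw [FiniteFreeMap.range_next]
    exact hz
  exact this

/-- Finiteness of the terms makes the syzygies finitely presented, as the duality argument for a
canonical module requires. -/
theorem exists_finite_freeResolution [IsNoetherianRing S] (I : Ideal S) :
    ∃ G : FreeResolution I, ∀ n, Module.Finite S (G.res.complex.X n) := by
  obtain ⟨b, f₀, hf₀⟩ := Module.Finite.exists_fin' S (S ⧸ I)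
  obtain ⟨c, f, hf⟩ := exists_range_eq (LinearMap.ker f₀)
  let s : FiniteFreeMap S := ⟨b, c, f⟩
  let e : s.complex.X 0 ⟶ cyc I := ModuleCat.ofHom f₀
  have he : s.complex.d 1 0 ≫ e = 0 := by
    rw [FiniteFreeMap.complex_d]
    ext1
    refine LinearMap.ext fun z => ?_
    have : f z ∈ LinearMap.ker f₀ := by
      rw [← hf]
      exact ⟨z, rfl⟩
    exact this
  have hfree : ∀ n, Module.Free S (s.complex.X n) := fun n =>
    inferInstanceAs (Module.Free S (Fin (s.iter n).tgt → S))
  have hfin : ∀ n, Module.Finite S (s.complex.X n) := fun n =>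
    inferInstanceAs (Module.Finite S (Fin (s.iter n).tgt → S))
  let π : s.complex ⟶ (ChainComplex.single₀ _).obj (cyc I) :=
    (ChainComplex.toSingle₀Equiv _ _).symm ⟨e, he⟩
  have hπ : QuasiIso π := ⟨fun n => by
    cases n
    -- In degree `0` the claim amounts to exactness of `F_1 → F_0 → S/I → 0`.
    · rw [ChainComplex.quasiIsoAt₀_iff, ShortComplex.quasiIso_iff_of_zeros']
      · refine (ShortComplex.exact_and_epi_g_iff_of_iso
          (S₂ := ShortComplex.mk (s.complex.d 1 0) e he) ?_).2 ⟨?_, ?_⟩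
        · exact ShortComplex.isoMk (Iso.refl _) (Iso.refl _) (Iso.refl _)
            (by simp; exact (Category.id_comp _).trans (Category.comp_id _).symm)
            (by simp [π]; exact (Category.id_comp _).trans (Category.comp_id _).symm)
        · rw [ShortComplex.moduleCat_exact_iff]
          intro z hz
          change f₀ z = 0 at hz
          change ∃ z', (s.complex.d 1 0).hom z' = z
          rw [FiniteFreeMap.complex_d]
          have : z ∈ LinearMap.range f := by
            rw [hf]
            exact hz
          exact this
        · exact (ModuleCat.epi_iff_surjective e).2 hf₀
      all_goals rfl
    · rw [quasiIsoAt_iff_exactAt']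
      · apply FiniteFreeMap.complex_exactAt
      · apply ChainComplex.exactAt_succ_single_obj⟩
  exact ⟨{
    res :=
      { complex := s.complex
        projective := fun n => (IsProjective.iff_projective _).1 inferInstance
        π := π }
    free := hfree }, hfin⟩

end FiniteFree

/-! ### Consequences of the data -/

section Data

/-- The sequence `x_1, x_2^v, …, x_d^v`. -/
def powTail {d : ℕ} [NeZero d] (x : Fin d → S) (v : ℕ) : Fin d → S :=
  Function.update (fun i => x i ^ v) 0 (x 0)

theorem powTail_zero {d : ℕ} [NeZero d] (x : Fin d → S) (v : ℕ) : powTail x v 0 = x 0 :=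
  Function.update_self _ _ _

/-- This identity lets the datum `(x_1, x_2^v, …, x_d^v)`, `q`, `wv` absorb the exponent `v` in
statement (i). -/
theorem seqPow_powTail {d : ℕ} [NeZero d] (x : Fin d → S) (w v : ℕ) (i : Fin d) :
    seqPow (powTail x v) (w * v) i = seqPow x w i ^ v := by
  by_cases hi : i = 0
  · subst hi
    rw [seqPow, seqPow, Function.update_self, Function.update_self, powTail_zero, pow_mul]
  · rw [seqPow, seqPow, Function.update_of_ne hi, Function.update_of_ne hi, powTail,
      Function.update_of_ne hi]

variable [IsLocalRing S]

theorem IsDatum.adjoin_le {d : ℕ} [NeZero d] {x : Fin d → S} {q : Ideal S} {w : ℕ}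
    (h : IsDatum x q w) (k : ℕ) (hk : 1 ≤ k) : adjoin q (x 0 ^ k) ≤ maximalIdeal S := by
  have hq : q ≠ ⊤ := by
    rintro rfl
    have := h.height_eq
    rw [Ideal.height_top] at this
    exact ENat.natCast_ne_top _ this.symm
  refine sup_le (IsLocalRing.le_maximalIdeal hq) ?_
  rw [Ideal.span_le, Set.singleton_subset_iff]
  refine Ideal.pow_mem_of_mem _ ?_ k hk
  rw [← h.sop]
  exact Ideal.le_radical (Ideal.subset_span ⟨0, rfl⟩)

theorem IsDatum.seqPow_mem {d : ℕ} [NeZero d] {x : Fin d → S} {q : Ideal S} {w : ℕ}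
    (h : IsDatum x q w) (i : Fin d) : seqPow x w i ∈ adjoin q (x 0 ^ w) := by
  by_cases hi : i = 0
  · subst hi
    rw [seqPow, Function.update_self]
    exact Ideal.mem_sup_right (Ideal.mem_span_singleton_self _)
  · rw [seqPow, Function.update_of_ne hi]
    exact Ideal.mem_sup_left (h.mem i hi)

theorem maximalIdeal_le_radical_of_pow_mem {d : ℕ} {x y : Fin d → S}
    (hx : GeneratesPrimary x) (hy : ∀ i, ∃ k, x i ^ k ∈ Ideal.span (Set.range y)) :
    maximalIdeal S ≤ (Ideal.span (Set.range y)).radical := by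
  rw [← hx]
  apply Ideal.radical_le_radical_iff.2
  rw [Ideal.span_le]
  rintro _ ⟨i, rfl⟩
  exact hy i

theorem IsDatum.maximalIdeal_le_radical {d : ℕ} [NeZero d] {x : Fin d → S} {q : Ideal S} {w : ℕ}
    (h : IsDatum x q w) : maximalIdeal S ≤ (Ideal.span (Set.range (seqPow x w))).radical := by
  refine maximalIdeal_le_radical_of_pow_mem h.sop fun i => ?_
  by_cases hi : i = 0
  · subst hi
    exact ⟨w, Ideal.subset_span ⟨0, by rw [seqPow, Function.update_self]⟩⟩
  · exact ⟨1, Ideal.subset_span ⟨i, by rw [seqPow, Function.update_of_ne hi, pow_one]⟩⟩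

theorem exists_maximalIdeal_pow_le [IsNoetherianRing S] {b : Ideal S}
    (h : maximalIdeal S ≤ b.radical) (N : ℕ) : ∃ k, maximalIdeal S ^ k ≤ b ^ N := by
  obtain ⟨k, hk⟩ := Ideal.exists_pow_le_of_le_radical_of_fg h
    (IsNoetherian.noetherian (maximalIdeal S))
  exact ⟨k * N, by rw [pow_mul]; exact Ideal.pow_right_mono hk N⟩

theorem IsDatum.powTail {d : ℕ} [NeZero d] {x : Fin d → S} {q : Ideal S} {w : ℕ}
    (h : IsDatum x q w) {v : ℕ} (hv : 1 ≤ v) : IsDatum (powTail x v) q (w * v) where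
  sop := by
    apply le_antisymm
    · rw [← h.sop]
      apply Ideal.radical_mono
      rw [Ideal.span_le]
      rintro _ ⟨i, rfl⟩
      by_cases hi : i = 0
      · subst hi
        rw [powTail_zero]
        exact Ideal.subset_span (Set.mem_range_self 0)
      · rw [CanonicalElement.powTail, Function.update_of_ne hi]
        exact Ideal.pow_mem_of_mem _ (Ideal.subset_span (Set.mem_range_self i)) v hv
    · refine maximalIdeal_le_radical_of_pow_mem h.sop fun i => ?_
      by_cases hi : i = 0
      · subst hi
        refine ⟨1, ?_⟩
        rw [pow_one, ← powTail_zero x v]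
        exact Ideal.subset_span ⟨0, rfl⟩
      · refine ⟨v, ?_⟩
        have : CanonicalElement.powTail x v i = x i ^ v := by
          rw [CanonicalElement.powTail, Function.update_of_ne hi]
        rw [← this]
        exact Ideal.subset_span ⟨i, rfl⟩
  height_eq := h.height_eq
  mem i hi := by
    rw [CanonicalElement.powTail, Function.update_of_ne hi]
    exact Ideal.pow_mem_of_mem _ (h.mem i hi) v hv
  one_le := Nat.mul_pos h.one_le hv

end Data

/-! ### Statements (i)–(iv) -/

section Equivalences

variable {I J : Ideal S}

theorem FreeResolution.toSyz_dl (G : FreeResolution I) (n : ℕ) (z : G.res.complex.X (n + 1)) :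
    G.toSyz n (dl G.res.complex n z) = 0 :=
  (Submodule.Quotient.mk_eq_zero _).2 ⟨z, rfl⟩

theorem FreeResolution.exists_dl_eq (G : FreeResolution I) (n : ℕ) {z : G.res.complex.X n}
    (h : G.toSyz n z = 0) : ∃ z', dl G.res.complex n z' = z :=
  (Submodule.Quotient.mk_eq_zero _).1 h

theorem FreeResolution.epsilon_eq (G : FreeResolution I) (n : ℕ) :
    G.epsilon (n + 1) = cls G.res (M := ModuleCat.of S (G.syz (n + 1))) (G.toSyz (n + 1))
      (G.toSyz_dl (n + 1)) := rfl

/-- The map on syzygies induced by a chain map. -/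
def syzMap {G : FreeResolution I} {G' : FreeResolution J} (θ : G.res.complex ⟶ G'.res.complex)
    (n : ℕ) : G.syz n →ₗ[S] G'.syz n :=
  Submodule.mapQ _ _ (θ.f n).hom (by
    rintro _ ⟨z, rfl⟩
    exact ⟨(θ.f (n + 1)).hom z, comm_apply θ n z⟩)

theorem syzMap_toSyz {G : FreeResolution I} {G' : FreeResolution J}
    (θ : G.res.complex ⟶ G'.res.complex) (n : ℕ) (z : G.res.complex.X n) :
    syzMap θ n (G.toSyz n z) = G'.toSyz n ((θ.f n).hom z) := rfl

variable {n : ℕ}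

theorem badRelation_one_iff {x : Fin (n + 1) → S} {w : ℕ} {G : FreeResolution I}
    {φ : koszulComplex (seqPow x w) ⟶ G.res.complex} : BadRelation x w φ 1 ↔
      G.toSyz (n + 1) (x 0 ^ (w - 1) • (φ.f (n + 1)).hom (koszulTop (seqPow x w))) ∈
        Ideal.span (Set.range (seqPow x w)) • (⊤ : Submodule S (G.syz (n + 1))) := by
  simp only [BadRelation, Nat.sub_self, pow_zero, Finset.prod_const_one, one_smul, pow_one]

variable [IsLocalRing S]

theorem monomialFormOne_of_monomialForm (h : MonomialForm S (n + 1)) :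
    MonomialFormOne S (n + 1) := fun x q w hx G φ hφ hb =>
  h x q w hx G φ hφ 1 le_rfl (badRelation_one_iff.2 hb)

/-- Multiplication by `x_1^{wv-w}` from `S/(q, x_1^w)` to `S/(q, x_1^{wv})` lifts to `θ : G → G'`.
It carries a relation with exponent `v` for the old datum to one with exponent `1` for the new
datum. -/
theorem monomialForm_of_monomialFormOne [IsNoetherianRing S] (h : MonomialFormOne S (n + 1)) :
    MonomialForm S (n + 1) := by
  intro x q w hx G φ hφ v hv hb
  have hx' := hx.powTail hv
  obtain ⟨G', -⟩ := exists_finite_freeResolution (adjoin q (powTail x v 0 ^ (w * v)))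
  obtain ⟨φ', hφ'⟩ := exists_liftsScalar (y := seqPow (powTail x v) (w * v)) G'.res 1
    (fun i => by rw [one_mul]; exact hx'.seqPow_mem i)
  refine h _ q _ hx' G' φ' ((liftsMul_iff _ _).2 hφ') ?_
  have hwv : w ≤ w * v := Nat.le_mul_of_pos_right w hv
  let f : cyc (adjoin q (x 0 ^ w)) ⟶ cyc (adjoin q (powTail x v 0 ^ (w * v))) :=
    ModuleCat.ofHom (Submodule.mapQ _ _ (LinearMap.mulLeft S (x 0 ^ (w * v - w))) (by
      refine sup_le (fun z hz => ?_) ?_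
      · exact Ideal.mem_sup_left (Ideal.mul_mem_left _ _ hz)
      · rw [Ideal.span_le, Set.singleton_subset_iff]
        refine Ideal.mem_sup_right ?_
        have h : x 0 ^ (w * v - w) * x 0 ^ w = x 0 ^ (w * v) := by
          rw [← pow_add, Nat.sub_add_cancel hwv]
        simp [h, powTail_zero]))
  obtain ⟨θ, hθ⟩ := exists_hom_over G.res G'.res f
  have hy : ∀ i, seqPow (powTail x v) (w * v) i = seqPow x w i ^ (v - 1) * seqPow x w i :=
    fun i => by rw [seqPow_powTail, ← pow_succ, Nat.sub_add_cancel hv]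
  -- Both chain maps `K(y^v) → G'` lift multiplication by `x_1^{wv-w}`, so their top values agree
  -- modulo `(y^v)`.
  have h1 := cocycle_top_sub_mem G'.res (M := ModuleCat.of S (G'.syz (n + 1)))
    (φ := koszulScale hy ≫ φ ≫ θ) (ψ := x 0 ^ (w * v - w) • φ') (fun z => by
      rw [comp_hom_apply, comp_hom_apply, smul_hom_apply, map_smul, hθ,
        (liftsMul_iff _ _).1 hφ, hφ', koszulZero_koszulScale]
      simp only [one_mul]
      rfl)
    (G'.toSyz (n + 1)) (G'.toSyz_dl (n + 1))
  have h2 := linearMap_mem_smul_top (syzMap (G' := G') θ (n + 1)) hb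
  rw [syzMap_toSyz] at h2
  have hset : (fun i => seqPow x w i ^ v) = seqPow (powTail x v) (w * v) :=
    funext fun i => (seqPow_powTail x w v i).symm
  rw [hset] at h2
  have h3 := Submodule.sub_mem _ h2 (Submodule.smul_mem _ (x 0 ^ (w - 1)) h1)
  rw [comp_hom_apply, comp_hom_apply, smul_hom_apply, koszulScale_top] at h3
  simp only [map_smul, smul_sub] at h3
  rw [smul_comm (x 0 ^ (w - 1)) (∏ i, _), sub_sub_cancel, smul_smul, ← pow_add] at h3
  have hp : powTail x v 0 ^ (w * v - 1) = x 0 ^ (w - 1 + (w * v - w)) := by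
    have := hx.one_le
    rw [powTail_zero, show w * v - 1 = w - 1 + (w * v - w) by omega]
  rwa [hp, map_smul]

/-- If `x_1^{w-1} η` vanishes, then `x_1^{w-1} ε` already dies over some `S/I^m`. As `I^m` contains
all `y_i^m`, the relation excluded by (i) results for `v = m`. -/
theorem etaForm_of_monomialForm (h : MonomialForm S (n + 1)) : EtaForm S (n + 1) := by
  intro x q w hx G h0
  obtain ⟨φ, hφ⟩ := exists_liftsScalar (y := seqPow x w) G.res 1
    (fun i => by rw [one_mul]; exact hx.seqPow_mem i)
  rw [FreeResolution.eta, ← map_smul] at h0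
  obtain ⟨m, hm1, hm, h0⟩ := exists_extMap_eq_zero_of_theta_eq_zero h0
  rw [FreeResolution.epsilon_eq, smul_cls] at h0
  have hy : ∀ i, seqPow x w i ^ m = seqPow x w i ^ (m - 1) * seqPow x w i := fun i => by
    rw [← pow_succ, Nat.sub_add_cancel hm1]
  have h1 := prod_smul_mem_of_smul_extMap_eq_zero hy G.res φ hφ _ _ hm
    ((one_smul _ _).trans h0) (fun i => Ideal.pow_mem_pow (hx.seqPow_mem i) m)
  refine h x q w hx G φ ((liftsMul_iff _ _).2 hφ) m hm1 ?_
  rw [BadRelation, map_smul, map_smul]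
  exact h1

/-- When `φ_d = 0` the cocycle has value `0 ∈ (y) syz_d`, so `x_1^{w-1} ε` dies over all small
enough ideals. -/
theorem liftForm_of_etaForm [IsNoetherianRing S] (h : EtaForm S (n + 1)) :
    LiftForm S (n + 1) := by
  intro x q w hx G φ hφ h0
  refine h x q w hx G ?_
  obtain ⟨N, hN⟩ := exists_smul_extMap_eq_zero (M := ModuleCat.of S (G.syz (n + 1))) G.res φ
    ((liftsMul_iff _ _).1 hφ) (G.toSyz (n + 1)) (G.toSyz_dl (n + 1)) (by
      rw [h0]
      exact Submodule.zero_mem _)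
  obtain ⟨k, hk⟩ := exists_maximalIdeal_pow_le hx.maximalIdeal_le_radical N
  -- The exponent `k + 1` is positive, which keeps the power inside the ideal itself.
  have hk' : adjoin q (x 0 ^ w) ^ (k + 1) ≤ Ideal.span (Set.range (seqPow x w)) ^ N :=
    ((Ideal.pow_right_mono (hx.adjoin_le w hx.one_le) _).trans
      (Ideal.pow_le_pow_right (Nat.le_succ k))).trans hk
  have hI : adjoin q (x 0 ^ w) ^ (k + 1) ≤ adjoin q (x 0 ^ w) := Ideal.pow_le_self (by omega)
  have := hN _ hk' hI
  rw [FreeResolution.eta, FreeResolution.epsilon_eq, ← map_smul]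
  refine theta_eq_zero hI ?_ le_rfl
  rw [map_smul]
  exact this

/-- The relation makes `s • φ_d`, taken modulo boundaries, factor through the Koszul differential.
Subtracting the resulting homotopy leaves a lift of multiplication by `s` with zero top component.
-/
theorem monomialFormOne_of_liftForm (h : LiftForm S (n + 1)) : MonomialFormOne S (n + 1) := by
  intro x q w hx G φ hφ hb
  set s := x 0 ^ (w - 1)
  let y := seqPow x w
  let K := koszulComplex y
  obtain ⟨u, hu⟩ := exists_comp_dl_eq y (G.toSyz (n + 1) ∘ₗ (s • (φ.f (n + 1)).hom)) hb
  obtain ⟨k, hk⟩ := Module.projective_lifting_property (G.toSyz (n + 1)) u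
    (Submodule.mkQ_surjective _)
  have hk' : ∀ z : K.X (n + 1), ∃ z', dl G.res.complex (n + 1) z' =
      s • (φ.f (n + 1)).hom z - k (dl K n z) := fun z => by
    apply G.exists_dl_eq
    have h1 := hu z
    have h2 := LinearMap.congr_fun hk (dl K n z)
    rw [map_sub, sub_eq_zero]
    exact h1.trans h2.symm
  have hks : ∀ z : K.X (n + 1), dl G.res.complex n (k (dl K n z)) =
      s • (φ.f n).hom (dl K n z) := fun z => by
    obtain ⟨z', hz'⟩ := hk' z
    have := dl_dl G.res.complex n z'
    rw [hz', map_sub, sub_eq_zero, map_smul, comm_apply] at this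
    exact this.symm
  -- Only degrees `d - 1` and `d` change. In degree `d` the value `s φ - k ∂` is a boundary and is
  -- replaced by zero.
  let g : ∀ j, K.X j →ₗ[S] G.res.complex.X j := Function.update (Function.update
    (fun j => s • (φ.f j).hom) n (s • (φ.f n).hom - dl G.res.complex n ∘ₗ k)) (n + 1) 0
  have g1 : g (n + 1) = 0 := Function.update_self _ _ _
  have g2 : g n = s • (φ.f n).hom - dl G.res.complex n ∘ₗ k := by
    change Function.update _ _ _ _ = _
    rw [Function.update_of_ne (by omega), Function.update_self]
  have g3 : ∀ j, j ≠ n → j ≠ n + 1 → g j = s • (φ.f j).hom := fun j h1 h2 => by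
    change Function.update _ _ _ _ = _
    rw [Function.update_of_ne h2, Function.update_of_ne h1]
  have hg : ∀ j z, dl G.res.complex j (g (j + 1) z) = g j (dl K j z) := by
    intro j z
    by_cases h1 : j = n
    · subst h1
      rw [g1, g2, LinearMap.zero_apply, map_zero, LinearMap.sub_apply, LinearMap.comp_apply, hks,
        LinearMap.smul_apply, sub_self]
    by_cases h2 : j + 1 = n
    · subst h2
      rw [g2, g3 j (by omega) (by omega), LinearMap.sub_apply, LinearMap.comp_apply, map_sub,
        dl_dl, sub_zero, LinearMap.smul_apply, LinearMap.smul_apply, map_smul, comm_apply]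
    by_cases h3 : j = n + 1
    · have : Subsingleton (K.X (j + 1)) := koszul_subsingleton y (by omega)
      rw [this.elim z 0, map_zero, map_zero, map_zero, map_zero]
    · rw [g3 j h1 h3, g3 (j + 1) h2 (by omega), LinearMap.smul_apply, LinearMap.smul_apply,
        map_smul, comm_apply]
  refine h x q w hx G (homOfComm g hg) ((liftsMul_iff _ _).2 fun z => ?_) ?_
  · have e : resAug G.res (g 0 z) = resAug G.res (s • (φ.f 0).hom z) := by
      -- For `d = 1` the altered degree is degree `0` itself, and the correction is a boundary,
      -- which the augmentation kills.
      by_cases h0 : n = 0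
      · subst h0
        rw [g2, LinearMap.sub_apply, map_sub, LinearMap.comp_apply, resAug_dl, sub_zero,
          LinearMap.smul_apply]
      · rw [g3 0 (Ne.symm h0) (by omega), LinearMap.smul_apply]
    refine e.trans ?_
    rw [map_smul, (liftsMul_iff _ _).1 hφ, one_mul, map_mul]
    rfl
  · change ModuleCat.ofHom (g (n + 1)) = 0
    rw [g1]
    rfl

end Equivalences

/-! ### Statements (iv)–(vi) -/

section CanonicalModule

theorem extMap_comp_mk₀ {A B M N : ModuleCat.{u} S} (f : A ⟶ B) (g : M ⟶ N) (m : ℕ)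
    (ξ : Ext B M m) : extMap f N m (ξ.comp (Ext.mk₀ g) (add_zero m)) =
      (extMap f M m ξ).comp (Ext.mk₀ g) (add_zero m) :=
  (Ext.comp_assoc_of_third_deg_zero (Ext.mk₀ f) ξ (Ext.mk₀ g) (zero_add m)).symm

variable [IsLocalRing S] {n : ℕ} {ω : ModuleCat.{u} S}

/-- The class `ε` is universal: a cocycle `G_d → ω` factors through `syz_d`, so each class is the
image of `ε` under some map `syz_d → ω`. Hence `x_1^{w-1} η = 0` forces the map in (vi) to vanish.
-/
theorem etaForm_of_extMulForm (h : ExtMulForm (n + 1) ω) : EtaForm S (n + 1) := by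
  intro x q w hx G h0
  refine h x q w hx (LinearMap.ext fun ξ => ?_)
  rw [FreeResolution.eta, ← map_smul] at h0
  obtain ⟨m, -, hm, h0⟩ := exists_extMap_eq_zero_of_theta_eq_zero h0
  obtain ⟨c, hc, rfl⟩ := cls_surjective G.res ξ
  let c' : G.syz (n + 1) →ₗ[S] ω := Submodule.liftQ _ c (by
    rintro _ ⟨z, rfl⟩
    exact hc z)
  have hξ : cls G.res c hc = (G.epsilon (n + 1)).comp (Ext.mk₀ (ModuleCat.ofHom c'))
      (add_zero _) := by
    rw [FreeResolution.epsilon_eq, cls_comp_mk₀]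
    rfl
  have h1 : extMap (cycMap hm) ω (n + 1) (x 0 ^ (w - 1) • cls G.res c hc) = 0 := by
    have h2 : extMap (cycMap hm) ω (n + 1) (x 0 ^ (w - 1) • cls G.res c hc) =
        (extMap (cycMap hm) (ModuleCat.of S (G.syz (n + 1))) (n + 1) (x 0 ^ (w - 1) • G.epsilon (n + 1))).comp
          (Ext.mk₀ (ModuleCat.ofHom c')) (add_zero (n + 1)) := by
      rw [hξ, ← Ext.smul_comp (R := S), extMap_comp_mk₀]
    rw [h2, h0, Ext.zero_comp]
  change x 0 ^ (w - 1) • theta (adjoin q (x 0 ^ w)) (n + 1) ω (cls G.res c hc) = 0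
  rw [← map_smul]
  exact theta_eq_zero hm h1 le_rfl

/-- On a common smaller ideal `J`, restriction after `ν_w` equals restriction of `x_1^{w-1} ξ`. The
powers of `(q, x_1)` and of `(q, x_1^w)` are cofinal in each other. -/
theorem theta_extMap_nu_eq_zero_iff {x : Fin (n + 1) → S} {q : Ideal S} {w : ℕ}
    (h : IsDatum x q w) [IsNoetherianRing S] (ξ : Ext (cyc (adjoin q (x 0 ^ w))) ω (n + 1)) :
    theta (adjoin q (x 0)) (n + 1) ω (extMap (nu q (x 0) w h.one_le) ω (n + 1) ξ) = 0 ↔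
      x 0 ^ (w - 1) • theta (adjoin q (x 0 ^ w)) (n + 1) ω ξ = 0 := by
  have hle : adjoin q (x 0 ^ w) ≤ adjoin q (x 0) := by
    refine sup_le_sup le_rfl ?_
    rw [Ideal.span_le, Set.singleton_subset_iff]
    exact Ideal.pow_mem_of_mem _ (Ideal.mem_span_singleton_self _) w h.one_le
  have hnu : ∀ {J : Ideal S} (h1 : J ≤ adjoin q (x 0)) (h2 : J ≤ adjoin q (x 0 ^ w)),
      extMap (cycMap h1) ω (n + 1) (extMap (nu q (x 0) w h.one_le) ω (n + 1) ξ) =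
        extMap (cycMap h2) ω (n + 1) (x 0 ^ (w - 1) • ξ) := by
    intro J h1 h2
    have e : cycMap h1 ≫ nu q (x 0) w h.one_le = x 0 ^ (w - 1) • cycMap h2 := by
      refine ModuleCat.hom_ext (LinearMap.ext fun z => ?_)
      obtain ⟨r, rfl⟩ := Ideal.Quotient.mk_surjective z
      rfl
    rw [extMap_comp, map_smul, ← extMap_smul, e]
  rw [← map_smul]
  constructor
  · intro h0
    obtain ⟨m, hm1, hm, h0⟩ := exists_extMap_eq_zero_of_theta_eq_zero h0
    have hJ : adjoin q (x 0 ^ w) ^ m ≤ adjoin q (x 0) ^ m := Ideal.pow_right_mono hle m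
    have hJ' : adjoin q (x 0 ^ w) ^ m ≤ adjoin q (x 0 ^ w) := Ideal.pow_le_self (by omega)
    refine theta_eq_zero hJ' ?_ le_rfl
    rw [← hnu (hJ.trans hm) hJ', ← cycMap_comp hJ hm, ← extMap_comp, h0, map_zero]
  · intro h0
    obtain ⟨m, hm1, hm, h0⟩ := exists_extMap_eq_zero_of_theta_eq_zero h0
    have hrad : maximalIdeal S ≤ (adjoin q (x 0 ^ w)).radical := by
      refine h.maximalIdeal_le_radical.trans (Ideal.radical_mono ?_)
      rw [Ideal.span_le]
      rintro _ ⟨i, rfl⟩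
      exact h.seqPow_mem i
    obtain ⟨k, hk⟩ := exists_maximalIdeal_pow_le hrad m
    refine theta_eq_zero (J := adjoin q (x 0 ^ w) ^ m) (hm.trans hle) ?_
      (((Ideal.pow_right_mono (by simpa using h.adjoin_le 1 le_rfl) k)).trans hk)
    rw [hnu _ hm, h0]

theorem extNuForm_iff_extMulForm [IsNoetherianRing S] :
    ExtNuForm (n + 1) ω ↔ ExtMulForm (n + 1) ω := by
  have key : ∀ (x : Fin (n + 1) → S) (q : Ideal S) (w : ℕ) (h : IsDatum x q w),
      theta (adjoin q (x 0)) (n + 1) ω ∘ₗ extMap (nu q (x 0) w h.one_le) ω (n + 1) = 0 ↔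
        LinearMap.lsmul S _ (x 0 ^ (w - 1)) ∘ₗ theta (adjoin q (x 0 ^ w)) (n + 1) ω = 0 := by
    intro x q w h
    rw [LinearMap.ext_iff, LinearMap.ext_iff]
    exact forall_congr' fun ξ => theta_extMap_nu_eq_zero_iff h ξ
  exact forall_congr' fun x => forall_congr' fun q => forall_congr' fun w =>
    forall_congr' fun h => not_congr (key x q w h)

end CanonicalModule

/-! ### Duality with values in an injective module -/

section Duality

open TensorProduct

/-- For `M` finitely presented and `E` injective, `M ⊗ Hom(ω, E) → Hom(Hom(M, ω), E)` detects
pure tensors. -/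
theorem tmul_eq_zero_of_forall_apply_eq_zero [IsNoetherianRing S] {M ω E : Type u}
    [AddCommGroup M] [Module S M] [Module.Finite S M] [AddCommGroup ω] [Module S ω]
    [AddCommGroup E] [Module S E] (hE : Module.Injective.{u, u} S E) (m : M) (ψ : ω →ₗ[S] E)
    (h : ∀ c : M →ₗ[S] ω, ψ (c m) = 0) : m ⊗ₜ[S] ψ = 0 := by
  obtain ⟨a, π, hπ⟩ := Module.Finite.exists_fin' S M
  obtain ⟨b, ρ, hρ⟩ := exists_range_eq (LinearMap.ker π)
  obtain ⟨v, rfl⟩ := hπ m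
  let r : Fin b → Fin a → S := fun i => ρ (Pi.single i 1)
  -- From the presentation `S^b → S^a → M`, the kernel of `R : ω^a → ω^b` is `Hom(M, ω)`; on it `L`
  -- is evaluation at `m` followed by `ψ`.
  let R : (Fin a → ω) →ₗ[S] (Fin b → ω) :=
    LinearMap.pi fun i => ∑ j, r i j • LinearMap.proj j
  have hR : ∀ f i, R f i = ∑ j, r i j • f j := fun f i => by simp [R]
  let L : (Fin a → ω) →ₗ[S] E := ψ ∘ₗ ∑ j, v j • LinearMap.proj j
  have hL : ∀ f, L f = ψ (∑ j, v j • f j) := fun f => by simp [L]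
  have hker : LinearMap.ker R ≤ LinearMap.ker L := by
    intro f hf
    rw [LinearMap.mem_ker] at hf ⊢
    let g : (Fin a → S) →ₗ[S] ω := Fintype.linearCombination S f
    have hg : LinearMap.ker π ≤ LinearMap.ker g := by
      rw [← hρ]
      have : g ∘ₗ ρ = 0 := by
        apply LinearMap.pi_ext'
        intro i
        ext
        have := congrFun hf i
        rw [hR] at this
        simpa [g, Fintype.linearCombination_apply] using this
      rintro _ ⟨z, rfl⟩
      exact LinearMap.congr_fun this z
    let c : M →ₗ[S] ω := (LinearMap.ker π).liftQ g hg ∘ₗ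
      (π.quotKerEquivOfSurjective hπ).symm.toLinearMap
    have hc : c (π v) = g v := by
      have : (π.quotKerEquivOfSurjective hπ).symm (π v) = Submodule.Quotient.mk v := by
        rw [LinearEquiv.symm_apply_eq]
        rfl
      rw [LinearMap.comp_apply, LinearEquiv.coe_coe, this]
      rfl
    have := h c
    rw [hc] at this
    rw [hL]
    exact this
  -- As `L` vanishes on the kernel of `R`, it is defined on the image of `R` and extends to `ω^b` by
  -- injectivity of `E`.
  obtain ⟨μ, hμ⟩ := hE.out ((LinearMap.ker R).liftQ R le_rfl)
    (LinearMap.ker_eq_bot.1 (Submodule.ker_liftQ_eq_bot _ _ _ le_rfl))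
    ((LinearMap.ker R).liftQ L hker)
  have hμ' : ∀ f, μ (R f) = L f := fun f => hμ (Submodule.Quotient.mk f)
  have hv : ∀ j, v j • ψ = ∑ i, r i j • (μ ∘ₗ LinearMap.single S (fun _ => ω) i) := by
    intro j
    ext t
    have h1 := hμ' (Pi.single j t)
    have h2 : R (Pi.single j t) = ∑ i, r i j • Pi.single i t := by
      ext i
      rw [hR, Finset.sum_apply]
      simp [Pi.single_apply]
    have h3 : L (Pi.single j t) = v j • ψ t := by
      rw [hL]
      simp [Pi.single_apply]
    rw [h2, h3, map_sum] at h1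
    simp only [LinearMap.smul_apply, LinearMap.sum_apply, LinearMap.comp_apply,
      LinearMap.single_apply]
    rw [← h1]
    exact Finset.sum_congr rfl fun i _ => map_smul _ _ _
  have hπv : ∀ f : Fin a → S, π f = ∑ j, f j • π (Pi.single j 1) := fun f => by
    have hf : f = ∑ j, f j • Pi.single j (1 : S) := by
      ext j
      simp [Finset.sum_apply, Pi.single_apply]
    conv_lhs => rw [hf]
    rw [map_sum]
    exact Finset.sum_congr rfl fun j _ => map_smul _ _ _
  have hπr : ∀ i, ∑ j, r i j • π (Pi.single j 1) = 0 := fun i => by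
    rw [← hπv]
    have : ρ (Pi.single i 1) ∈ LinearMap.ker π := by
      rw [← hρ]
      exact ⟨_, rfl⟩
    exact this
  -- Moving the coefficients `v j` onto `ψ` and expanding through `μ` turns `m ⊗ ψ` into a sum over
  -- `i` of tensors whose left factor is the relation `∑_j r i j • π(e_j) = 0`.
  rw [hπv, TensorProduct.sum_tmul]
  simp_rw [TensorProduct.smul_tmul, hv, TensorProduct.tmul_sum, ← TensorProduct.smul_tmul]
  rw [Finset.sum_comm]
  refine Finset.sum_eq_zero fun i _ => ?_
  rw [← TensorProduct.sum_tmul, hπr, TensorProduct.zero_tmul]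

end Duality

/-! ### The Koszul limit -/

section PowLim

variable {d : ℕ} (y : Fin d → S) (M : Type u) [AddCommGroup M] [Module S M]

/-- The submodule `(y_1^v, …, y_d^v) M`. -/
abbrev powSub (v : ℕ) : Submodule S M :=
  Ideal.span (Set.range fun i => y i ^ v) • (⊤ : Submodule S M)

theorem prod_smul_mem_powSub {v v' : ℕ} (h : v ≤ v') {m : M} (hm : m ∈ powSub y M v) :
    (∏ i, y i ^ (v' - v)) • m ∈ powSub y M v' := by
  have hle : powSub y M v ≤
      (powSub y M v').comap (LinearMap.lsmul S M (∏ i, y i ^ (v' - v))) := by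
    rw [Submodule.smul_le]
    intro r hr t _
    induction hr using Submodule.span_induction with
    | mem x hx =>
      obtain ⟨i, rfl⟩ := hx
      rw [Submodule.mem_comap, LinearMap.lsmul_apply, smul_smul]
      refine Submodule.smul_mem_smul ?_ trivial
      have : y i ^ v' ∣ (∏ j, y j ^ (v' - v)) * y i ^ v := by
        have h1 : y i ^ v' = y i ^ (v' - v) * y i ^ v := by
          rw [← pow_add, Nat.sub_add_cancel h]
        rw [h1]
        exact mul_dvd_mul_right (Finset.dvd_prod_of_mem (fun j => y j ^ (v' - v))
          (Finset.mem_univ i)) _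
      exact Ideal.mem_of_dvd _ this (Ideal.subset_span ⟨i, rfl⟩)
    | zero => rw [zero_smul]; exact Submodule.zero_mem _
    | add a b _ _ ha hb => rw [add_smul]; exact Submodule.add_mem _ ha hb
    | smul a b _ hb => rw [smul_assoc]; exact Submodule.smul_mem _ _ hb
  exact hle hm

/-- The transition map `M/(y^v) M → M/(y^{v'}) M`, multiplication by `(y_1 ⋯ y_d)^{v' - v}`. -/
def powTrans (v v' : ℕ) (h : v ≤ v') : M ⧸ powSub y M v →ₗ[S] M ⧸ powSub y M v' :=
  Submodule.mapQ _ _ (LinearMap.lsmul S M (∏ i, y i ^ (v' - v)))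
    fun _ hm => prod_smul_mem_powSub y M h hm

theorem powTrans_mk {v v' : ℕ} (h : v ≤ v') (m : M) :
    powTrans y M v v' h (Submodule.Quotient.mk m) =
      Submodule.Quotient.mk ((∏ i, y i ^ (v' - v)) • m) := rfl

instance : DirectedSystem (fun v => M ⧸ powSub y M v) (fun v v' h => powTrans y M v v' h) where
  map_self v m := by
    obtain ⟨m, rfl⟩ := Submodule.Quotient.mk_surjective _ m
    rw [powTrans_mk]
    simp
  map_map i j k hij hjk m := by
    obtain ⟨m, rfl⟩ := Submodule.Quotient.mk_surjective _ m
    rw [powTrans_mk, powTrans_mk, powTrans_mk, smul_smul, ← Finset.prod_mul_distrib]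
    congr 2
    refine Finset.prod_congr rfl fun l _ => ?_
    rw [← pow_add]
    congr 1
    omega

/-- The direct limit of the modules `M/(y_1^v, …, y_d^v) M`. -/
abbrev PowLim : Type u :=
  Module.DirectLimit (fun v => M ⧸ powSub y M v) (fun v v' h => powTrans y M v v' h)

/-- The class of `m` in the direct limit, through the index `v`. -/
def powOf (v : ℕ) : M →ₗ[S] PowLim y M :=
  Module.DirectLimit.of S ℕ (fun v => M ⧸ powSub y M v) (fun v v' h => powTrans y M v v' h) v ∘ₗ
    (powSub y M v).mkQ

theorem powOf_eq {v v' : ℕ} (h : v ≤ v') (m : M) :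
    powOf y M v m = powOf y M v' ((∏ i, y i ^ (v' - v)) • m) :=
  (Module.DirectLimit.of_f (G := fun v => M ⧸ powSub y M v)
    (f := fun v v' h => powTrans y M v v' h) (hij := h)).symm

theorem powOf_eq_zero {v : ℕ} {m : M} (h : m ∈ powSub y M v) : powOf y M v m = 0 := by
  rw [powOf, LinearMap.comp_apply, Submodule.mkQ_apply, (Submodule.Quotient.mk_eq_zero _).2 h,
    map_zero]

theorem exists_of_powOf_eq_zero {v : ℕ} {m : M} (h : powOf y M v m = 0) :
    ∃ v', v ≤ v' ∧ (∏ i, y i ^ (v' - v)) • m ∈ powSub y M v' := by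
  obtain ⟨v', hv, h⟩ := Module.DirectLimit.of.zero_exact h
  exact ⟨v', hv, (Submodule.Quotient.mk_eq_zero _).1 h⟩

theorem exists_powOf_eq (z : PowLim y M) : ∃ v m, powOf y M v m = z := by
  obtain ⟨v, m, rfl⟩ := Module.DirectLimit.exists_of z
  obtain ⟨m, rfl⟩ := Submodule.Quotient.mk_surjective _ m
  exact ⟨v, m, rfl⟩

/-- The pairing `S/(y^v) × M → lim M/(y^v) M`. -/
def powPairingAux (v : ℕ) : (S ⧸ powSub y S v) →ₗ[S] (M →ₗ[S] PowLim y M) :=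
  Submodule.liftQ (τ₁₂ := RingHom.id S) (M₂ := M →ₗ[S] PowLim y M) (powSub y S v)
    (LinearMap.toSpanSingleton S (M →ₗ[S] PowLim y M) (powOf y M v)) fun s hs => by
      rw [LinearMap.mem_ker]
      ext m
      rw [LinearMap.toSpanSingleton_apply, LinearMap.smul_apply, ← map_smul]
      refine powOf_eq_zero y M (Submodule.smul_mem_smul ?_ trivial)
      rwa [powSub, smul_eq_mul, Ideal.mul_top] at hs

/-- The pairing `lim S/(y^v) × M → lim M/(y^v) M`. -/
def powPairing : PowLim y S →ₗ[S] M →ₗ[S] PowLim y M :=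
  Module.DirectLimit.lift S ℕ _ _ (powPairingAux y M) fun v v' h s => by
    obtain ⟨s, rfl⟩ := Submodule.Quotient.mk_surjective _ s
    rw [powTrans_mk]
    ext m
    change ((∏ i, y i ^ (v' - v)) * s) • powOf y M v' m = s • powOf y M v m
    rw [powOf_eq y M h, map_smul, smul_smul, mul_comm]

theorem powPairing_powOf (v : ℕ) (s : S) (m : M) :
    powPairing y M (powOf y S v s) m = s • powOf y M v m := by
  rw [powPairing, powOf, LinearMap.comp_apply, Module.DirectLimit.lift_of]
  rfl

end PowLim

/-! ### Values of extension classes on Koszul complexes -/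

section Value

variable {I J : Ideal S} {n : ℕ} {M : ModuleCat.{u} S}

/-- Compatibility of the values of a class and of its restriction. -/
theorem value_sub_mem {a y y' : Fin (n + 1) → S} (h : ∀ i, y' i = a i * y i)
    (R : ProjectiveResolution (cyc I)) (R' : ProjectiveResolution (cyc J)) (hJ : J ≤ I)
    {φ : koszulComplex y ⟶ R.complex} (hφ : LiftsScalar R φ 1)
    {φ' : koszulComplex y' ⟶ R'.complex} (hφ' : LiftsScalar R' φ' 1)
    {c : R.complex.X (n + 1) →ₗ[S] M} (hc : ∀ z, c (dl R.complex (n + 1) z) = 0)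
    {c' : R'.complex.X (n + 1) →ₗ[S] M} (hc' : ∀ z, c' (dl R'.complex (n + 1) z) = 0)
    (e : extMap (cycMap hJ) M (n + 1) (cls R c hc) = cls R' c' hc') :
    (∏ i, a i) • c ((φ.f (n + 1)).hom (koszulTop y)) - c' ((φ'.f (n + 1)).hom (koszulTop y')) ∈
      Ideal.span (Set.range y') • (⊤ : Submodule S M) := by
  obtain ⟨θ, hθ⟩ := exists_hom_over R' R (cycMap hJ)
  rw [extMap_cls R (cycMap hJ) θ hθ] at e
  have e' : cls R' ((c ∘ₗ (θ.f (n + 1)).hom) + (-c')) (fun z => by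
      rw [LinearMap.add_apply, LinearMap.neg_apply, hc', neg_zero, add_zero,
        LinearMap.comp_apply, ← comm_apply, hc]) = 0 := by
    rw [← cls_add R' _ _ (fun z => by rw [LinearMap.comp_apply, ← comm_apply, hc])
      (fun z => by rw [LinearMap.neg_apply, hc', neg_zero]), e, cls_add]
    rw [cls_eq_zero_iff]
    exact ⟨0, fun z => by simp⟩
  obtain ⟨k, hk⟩ := (cls_eq_zero_iff _ _ _).1 e'
  have h1 := cocycle_top_sub_mem R (φ := koszulScale h ≫ φ) (ψ := φ' ≫ θ) (fun z => by
    rw [comp_hom_apply, comp_hom_apply, hθ, hφ, hφ', cycMap_mk, koszulZero_koszulScale]) c hc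
  have h2 : c ((θ.f (n + 1)).hom ((φ'.f (n + 1)).hom (koszulTop y'))) -
      c' ((φ'.f (n + 1)).hom (koszulTop y')) ∈
        Ideal.span (Set.range y') • (⊤ : Submodule S M) := by
    have h3 := hk ((φ'.f (n + 1)).hom (koszulTop y'))
    rw [LinearMap.add_apply, LinearMap.neg_apply, LinearMap.comp_apply, ← sub_eq_add_neg] at h3
    rw [h3, comm_apply]
    exact linearMap_mem_smul_top (k ∘ₗ (φ'.f n).hom) (dl_koszul_mem y' n _)
  have h3 := Submodule.add_mem _ h1 h2
  rwa [comp_hom_apply, comp_hom_apply, koszulScale_top, map_smul, map_smul,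
    sub_add_sub_cancel] at h3

variable (M) (y : Fin (n + 1) → S)

/-- Changing the lift, the representing cocycle or the resolution alters the value only by elements
of `(y)M`. Linearity follows from this independence, although representatives are chosen
arbitrarily. -/
theorem exists_value (hy : ∀ i, y i ∈ J) :
    ∃ α : Ext (cyc J) M (n + 1) →ₗ[S] M ⧸ (Ideal.span (Set.range y) • (⊤ : Submodule S M)),
      ∀ (R : ProjectiveResolution (cyc J)) (φ : koszulComplex y ⟶ R.complex),
        LiftsScalar R φ 1 → ∀ (c : R.complex.X (n + 1) →ₗ[S] M)
          (hc : ∀ z, c (dl R.complex (n + 1) z) = 0),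
          α (cls R c hc) = Submodule.Quotient.mk (c ((φ.f (n + 1)).hom (koszulTop y))) := by
  have hone : ∀ i, y i = (fun _ => (1 : S)) i * y i := fun i => (one_mul _).symm
  have key : ∀ (R R' : ProjectiveResolution (cyc J)) {φ : koszulComplex y ⟶ R.complex}
      (_ : LiftsScalar R φ 1) {φ' : koszulComplex y ⟶ R'.complex} (_ : LiftsScalar R' φ' 1)
      {c : R.complex.X (n + 1) →ₗ[S] M} (hc : ∀ z, c (dl R.complex (n + 1) z) = 0)
      {c' : R'.complex.X (n + 1) →ₗ[S] M} (hc' : ∀ z, c' (dl R'.complex (n + 1) z) = 0),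
      cls R c hc = cls R' c' hc' →
      (Submodule.Quotient.mk (c ((φ.f (n + 1)).hom (koszulTop y))) :
        M ⧸ (Ideal.span (Set.range y) • (⊤ : Submodule S M))) =
        Submodule.Quotient.mk (c' ((φ'.f (n + 1)).hom (koszulTop y))) := by
    intro R R' φ hφ φ' hφ' c hc c' hc' e
    have hid : cycMap (le_refl J) = 𝟙 _ := by
      refine ModuleCat.hom_ext (LinearMap.ext fun x => ?_)
      obtain ⟨r, rfl⟩ := Ideal.Quotient.mk_surjective x
      rfl
    have := value_sub_mem hone R R' le_rfl hφ hφ' hc hc' (by rw [hid, extMap_id, e])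
    rw [Finset.prod_const_one, one_smul] at this
    exact (Submodule.Quotient.eq _).2 this
  let R := projectiveResolution (cyc J)
  obtain ⟨φ, hφ⟩ := exists_liftsScalar (y := y) R 1 (by simpa using hy)
  choose c hc hcls using fun ξ => cls_surjective (M := M) (n := n) R ξ
  refine ⟨
    { toFun := fun ξ => Submodule.Quotient.mk (c ξ ((φ.f (n + 1)).hom (koszulTop y)))
      map_add' := fun ξ η => ?_
      map_smul' := fun s ξ => ?_ }, fun R' φ' hφ' c' hc' => ?_⟩
  · rw [← Submodule.Quotient.mk_add, ← LinearMap.add_apply]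
    refine key R R hφ hφ (hc _) (fun z => by simp [hc]) ?_
    rw [← cls_add _ _ _ (hc _) (hc _), hcls, hcls, hcls]
  · rw [RingHom.id_apply, ← Submodule.Quotient.mk_smul, ← LinearMap.smul_apply]
    refine key R R hφ hφ (hc _) (fun z => by simp [hc]) ?_
    rw [← smul_cls _ _ _ (hc _), hcls, hcls]
  · exact key R R' hφ hφ' _ hc' (hcls _)

end Value

/-! ### Local cohomology as a Koszul limit -/

section LocCohKoszul

variable [IsLocalRing S] {n : ℕ} (M : ModuleCat.{u} S) (y : Fin (n + 1) → S)

/-- The class in local cohomology of an element of `Ext`. -/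
abbrev locOf (k : ℕ) : Ext (cyc (maximalIdeal S ^ k)) M (n + 1) →ₗ[S]
    LocCoh (maximalIdeal S) (n + 1) M :=
  Module.DirectLimit.of S ℕ (fun m : ℕ => Ext (cyc (maximalIdeal S ^ m)) M (n + 1))
    (fun _ _ h => extMap (cycMap (Ideal.pow_le_pow_right h)) M (n + 1)) k

theorem exists_locCoh_to_powLim (hy : ∀ i, y i ∈ maximalIdeal S) :
    ∃ α : LocCoh (maximalIdeal S) (n + 1) M →ₗ[S] PowLim y M,
      ∀ (k : ℕ) (R : ProjectiveResolution (cyc (maximalIdeal S ^ k)))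
        (φ : koszulComplex (fun i => y i ^ k) ⟶ R.complex), LiftsScalar R φ 1 →
        ∀ (c : R.complex.X (n + 1) →ₗ[S] M) (hc : ∀ z, c (dl R.complex (n + 1) z) = 0),
          α (locOf M k (cls R c hc)) =
            powOf y M k (c ((φ.f (n + 1)).hom (koszulTop fun i => y i ^ k))) := by
  choose v hv using fun k : ℕ => exists_value (J := maximalIdeal S ^ k) M (fun i => y i ^ k)
    fun i => Ideal.pow_mem_pow (hy i) k
  refine ⟨Module.DirectLimit.map v fun k l hkl => LinearMap.ext fun ξ => ?_,
    fun k R φ hφ c hc => ?_⟩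
  · let R := projectiveResolution (cyc (maximalIdeal S ^ k))
    let R' := projectiveResolution (cyc (maximalIdeal S ^ l))
    obtain ⟨φ, hφ⟩ := exists_liftsScalar (y := fun i => y i ^ k) R 1
      (by simpa using fun i => Ideal.pow_mem_pow (hy i) k)
    obtain ⟨φ', hφ'⟩ := exists_liftsScalar (y := fun i => y i ^ l) R' 1
      (by simpa using fun i => Ideal.pow_mem_pow (hy i) l)
    obtain ⟨c, hc, rfl⟩ := cls_surjective R ξ
    obtain ⟨c', hc', e⟩ := cls_surjective R'
      (extMap (cycMap (Ideal.pow_le_pow_right hkl)) M (n + 1) (cls R c hc))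
    rw [LinearMap.comp_apply, LinearMap.comp_apply, ← e, hv l R' φ' hφ', hv k R φ hφ, powTrans_mk]
    refine ((Submodule.Quotient.eq _).2 (value_sub_mem (fun i => ?_) R R' _ hφ hφ' hc hc'
      e.symm)).symm
    rw [← pow_add, Nat.sub_add_cancel hkl]
  · rw [Module.DirectLimit.map_apply_of, hv k R φ hφ]
    rfl

theorem maximalIdeal_le_radical_pow {y : Fin (n + 1) → S}
    (hrad : maximalIdeal S ≤ (Ideal.span (Set.range y)).radical) (v : ℕ) :
    maximalIdeal S ≤ (Ideal.span (Set.range fun i => y i ^ v)).radical := by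
  refine hrad.trans (Ideal.radical_le_radical_iff.2 ?_)
  rw [Ideal.span_le]
  rintro _ ⟨i, rfl⟩
  exact ⟨v, Ideal.subset_span ⟨i, rfl⟩⟩

/-- Injectivity is the criterion that a class with value in `(y^V)M` dies over small ideals. For
surjectivity, `m ∈ M` at level `v` is realised by the cocycle `R_d → K_d(y^v) ≅ S → M`, with `R` a
resolution of `S/𝔪^k` for large `k`. -/
theorem exists_locCoh_equiv_powLim [IsNoetherianRing S] (hy : ∀ i, y i ∈ maximalIdeal S)
    (hrad : maximalIdeal S ≤ (Ideal.span (Set.range y)).radical) :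
    Nonempty (LocCoh (maximalIdeal S) (n + 1) M ≃ₗ[S] PowLim y M) := by
  obtain ⟨α, hα⟩ := exists_locCoh_to_powLim M y hy
  refine ⟨LinearEquiv.ofBijective α ⟨?_, fun z => ?_⟩⟩
  · rw [injective_iff_map_eq_zero]
    intro z hz
    obtain ⟨k, ξ, rfl⟩ := Module.DirectLimit.exists_of z
    let R := projectiveResolution (cyc (maximalIdeal S ^ k))
    obtain ⟨φ, hφ⟩ := exists_liftsScalar (y := fun i => y i ^ k) R 1
      (by simpa using fun i => Ideal.pow_mem_pow (hy i) k)
    obtain ⟨c, hc, rfl⟩ := cls_surjective R ξ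
    rw [hα k R φ hφ] at hz
    obtain ⟨V, hV, hz⟩ := exists_of_powOf_eq_zero y M hz
    have hs : ∀ i, y i ^ V = y i ^ (V - k) * y i ^ k := fun i => by
      rw [← pow_add, Nat.sub_add_cancel hV]
    obtain ⟨N, hN⟩ := exists_smul_extMap_eq_zero R (koszulScale hs ≫ φ) (s := 1) (fun p => by
      rw [comp_hom_apply, hφ, koszulZero_koszulScale]) c hc (by
        rw [comp_hom_apply, koszulScale_top, map_smul, map_smul]
        exact hz)
    obtain ⟨l, hl⟩ := exists_maximalIdeal_pow_le (maximalIdeal_le_radical_pow hrad V) N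
    have h1 := hN (maximalIdeal S ^ max k l)
      ((Ideal.pow_le_pow_right (le_max_right _ _)).trans hl)
      (Ideal.pow_le_pow_right (le_max_left _ _))
    rw [one_smul] at h1
    exact locCoh_of_eq_zero _ h1 le_rfl
  · obtain ⟨v, m, rfl⟩ := exists_powOf_eq y M z
    let yv : Fin (n + 1) → S := fun i => y i ^ v
    let b := Ideal.span (Set.range yv)
    obtain ⟨N₁, hN₁⟩ := exists_hom_to_koszul yv
    obtain ⟨N₀, A, hA, hAex, hA₀⟩ := exists_exactAlong_koszul yv
    have hradv := maximalIdeal_le_radical_pow hrad v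
    obtain ⟨k₁, hk₁⟩ := exists_maximalIdeal_pow_le hradv N₁
    obtain ⟨k₀, hk₀⟩ := exists_maximalIdeal_pow_le hradv N₀
    -- The bound by `v` allows the scaling `K(y^k) → K(y^v)`, that by `N₁` gives the map `R →
    -- K(y^v)`, and that by `N₀` makes the discrepancy in degree `0` deep enough to be a boundary.
    obtain ⟨k, hkv, hk1, hk0⟩ : ∃ k, v ≤ k ∧ maximalIdeal S ^ k ≤ b ^ N₁ ∧
        maximalIdeal S ^ k ≤ b ^ N₀ :=
      ⟨v + k₁ + k₀, by omega, (Ideal.pow_le_pow_right (by omega)).trans hk₁,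
        (Ideal.pow_le_pow_right (by omega)).trans hk₀⟩
    let R := projectiveResolution (cyc (maximalIdeal S ^ k))
    obtain ⟨f, hf⟩ := hN₁ _ hk1 R
    obtain ⟨φ, hφ⟩ := exists_liftsScalar (y := fun i => y i ^ k) R 1
      (by simpa using fun i => Ideal.pow_mem_pow (hy i) k)
    let c : R.complex.X (n + 1) →ₗ[S] M :=
      LinearMap.toSpanSingleton S M m ∘ₗ topCoord yv ∘ₗ (f.f (n + 1)).hom
    have hcv : ∀ z, c z = topCoord yv ((f.f (n + 1)).hom z) • m := fun z => rfl
    have hc : ∀ z, c (dl R.complex (n + 1) z) = 0 := fun z => by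
      have : (f.f (n + 2)).hom z = 0 := (koszul_subsingleton yv (by omega)).elim _ _
      rw [hcv, ← comm_apply, this, map_zero, map_zero, zero_smul]
    refine ⟨locOf M k (cls R c hc), ?_⟩
    rw [hα k R φ hφ, powOf_eq y M hkv, ← sub_eq_zero, ← map_sub]
    have hkV : k ≤ k + v * N₀ := Nat.le_add_right _ _
    rw [powOf_eq y M hkV]
    apply powOf_eq_zero
    rw [smul_sub]
    -- The maps `φ ≫ f` and `σ₂` are compared after scaling by the `y_i^{v N₀} ∈ b^{N₀}`. This
    -- pushes their difference into the submodules `A`, where homotopies exist.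
    let yV : Fin (n + 1) → S := fun i => y i ^ (k + v * N₀)
    have hσ₁ : ∀ i, yV i = y i ^ (k + v * N₀ - k) * y i ^ k := fun i => by
      rw [← pow_add, Nat.sub_add_cancel hkV]
    have hσ₂ : ∀ i, y i ^ k = y i ^ (k - v) * yv i := fun i => by
      rw [← pow_add, Nat.sub_add_cancel hkv]
    let σ₁ : koszulComplex yV ⟶ koszulComplex fun i => y i ^ k := koszulScale hσ₁
    let σ₂ : (koszulComplex fun i => y i ^ k) ⟶ koszulComplex yv := koszulScale hσ₂
    have hσmem : ∀ j (z : (koszulComplex yV).X (j + 1)),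
        (σ₁.f (j + 1)).hom z ∈ b ^ N₀ • (⊤ : Submodule S _) := fun j z =>
      koszulScale_mem hσ₁ (fun i => by
        rw [Nat.add_sub_cancel_left, pow_mul]
        exact Ideal.pow_mem_pow (Ideal.subset_span (Set.mem_range_self i)) _) j z
    obtain ⟨h, hh⟩ := exists_homotopy_of_exactAlong hAex (σ₁ ≫ (φ ≫ f - σ₂)) (fun p => by
      apply hA₀
      apply mem_of_koszulZero_mem
      apply hk0
      rw [comp_hom_apply, HomologicalComplex.sub_f_apply, ModuleCat.hom_sub, LinearMap.sub_apply,
        map_sub, comp_hom_apply, koszulZero_koszulScale]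
      rw [← Ideal.Quotient.eq_zero_iff_mem, map_sub, hf, hφ, one_mul, sub_self])
      (fun j p => hA _ (by
        rw [comp_hom_apply]
        exact linearMap_mem_smul_top _ (hσmem j p))) n
    obtain ⟨z, -, hz⟩ := hh (koszulTop yV)
    -- The error term lies in `K_{d+1} = 0`, so in top degree the difference is exactly `h ∘ ∂`,
    -- with values in `(y^V)`.
    have hz0 : z = 0 := (koszul_subsingleton yv (by omega)).elim _ _
    rw [hz0, map_zero, eq_comm, sub_eq_zero, comp_hom_apply, HomologicalComplex.sub_f_apply,
      ModuleCat.hom_sub, LinearMap.sub_apply, koszulScale_top, map_smul, map_smul, koszulScale_top,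
      comp_hom_apply] at hz
    have h1 := linearMap_mem_smul_top (LinearMap.toSpanSingleton S M m ∘ₗ topCoord yv ∘ₗ h)
      (dl_koszul_mem yV n (koszulTop yV))
    rw [LinearMap.comp_apply, LinearMap.comp_apply, ← hz, LinearMap.toSpanSingleton_apply, map_sub,
      map_smul, map_smul, map_smul, topCoord_top, sub_smul, smul_eq_mul, smul_eq_mul, smul_eq_mul,
      mul_one, mul_smul, mul_smul] at h1
    exact h1

end LocCohKoszul

/-! ### Detecting the canonical element with a canonical module -/

section Final

open TensorProduct

variable [IsLocalRing S] [IsNoetherianRing S] {n : ℕ}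

/-- Elements `e_v` of the top local cohomology of `S` that correspond to the classes of
`1 ∈ S/(y^v)`. -/
theorem exists_locCoh_generators {y : Fin (n + 1) → S} (hy : ∀ i, y i ∈ maximalIdeal S)
    (hrad : maximalIdeal S ≤ (Ideal.span (Set.range y)).radical) :
    ∃ e : ℕ → LocCoh (maximalIdeal S) (n + 1) (ModuleCat.of S S),
      (∀ v, 1 ≤ v → e 1 = (∏ i, y i ^ (v - 1)) • e v) ∧
      (∀ v, ∀ r ∈ Ideal.span (Set.range fun i => y i ^ v), r • e v = 0) ∧
      ∀ (M : Type u) [AddCommGroup M] [Module S M] (m : M), m ⊗ₜ[S] e 1 = 0 →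
        ∃ v, 1 ≤ v ∧ (∏ i, y i ^ (v - 1)) • m ∈ powSub y M v := by
  obtain ⟨α⟩ := exists_locCoh_equiv_powLim (ModuleCat.of S S) y hy hrad
  refine ⟨fun v => α.symm (powOf y S v 1), fun v hv => ?_, fun v r hr => ?_, fun M _ _ m hm => ?_⟩
  · rw [← map_smul, ← map_smul]
    exact congrArg α.symm (powOf_eq y S hv 1)
  · rw [← map_smul, ← map_smul]
    have : powOf y S v (r • 1) = 0 := powOf_eq_zero y S (Submodule.smul_mem_smul hr trivial)
    rw [this, map_zero]
  · let T : M ⊗[S] LocCoh (maximalIdeal S) (n + 1) (ModuleCat.of S S) →ₗ[S] PowLim y M :=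
      TensorProduct.lift ((powPairing y M ∘ₗ α.toLinearMap).flip)
    have hT := congrArg T hm
    have h1 : T (m ⊗ₜ[S] α.symm (powOf y S 1 1)) = powOf y M 1 m := by
      change powPairing y M (α (α.symm (powOf y S 1 1))) m = _
      rw [LinearEquiv.apply_symm_apply, powPairing_powOf, one_smul]
    rw [h1, map_zero] at hT
    exact exists_of_powOf_eq_zero y M hT

/-- Were the map in (vi) zero, every `c : syz_d → ω` would satisfy `∏ y_i^{v-1} c(m) ∈ (y^v) ω` for
some `v` depending on `c`. Duality removes this dependence and produces a relation in `syz_d`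
itself. -/
theorem extMulForm_of_monomialForm (hd : ringKrullDim S = (n + 1 : ℕ)) {ω : ModuleCat.{u} S}
    (hω : IsCanonicalModule ω) (h : MonomialForm S (n + 1)) : ExtMulForm (n + 1) ω := by
  obtain ⟨-, n', hn', E, j, hE, ⟨Φ⟩⟩ := hω
  obtain rfl : n' = n + 1 := by
    rw [hd] at hn'
    exact_mod_cast hn'.symm
  intro x q w hx h0
  let y := seqPow x w
  have hyI : ∀ i, y i ∈ adjoin q (x 0 ^ w) := hx.seqPow_mem
  obtain ⟨e, he, he0, het⟩ := exists_locCoh_generators (y := y)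
    (fun i => hx.adjoin_le w hx.one_le (hyI i)) hx.maximalIdeal_le_radical
  obtain ⟨G, hG⟩ := exists_finite_freeResolution (adjoin q (x 0 ^ w))
  obtain ⟨φ, hφ⟩ := exists_liftsScalar (y := y) G.res 1
    (fun i => by rw [one_mul]; exact hyI i)
  let m : G.syz (n + 1) := G.toSyz (n + 1) (x 0 ^ (w - 1) • (φ.f (n + 1)).hom (koszulTop y))
  -- Writing `e 1 = ∏ y_i^{v-1} • e v` moves the product onto `c m`, which lands in `(y^v) ω`, and
  -- `(y^v)` kills `e v`.
  have hzero : ∀ c : G.syz (n + 1) →ₗ[S] ω, Φ.symm (e 1) (c m) = 0 := by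
    intro c
    have hc : ∀ z, (c ∘ₗ G.toSyz (n + 1)) (dl G.res.complex (n + 1) z) = 0 := fun z => by
      rw [LinearMap.comp_apply, FreeResolution.toSyz_dl, map_zero]
    have h1 : x 0 ^ (w - 1) • theta (adjoin q (x 0 ^ w)) (n + 1) ω
        (cls G.res (c ∘ₗ G.toSyz (n + 1)) hc) = 0 := LinearMap.congr_fun h0 _
    rw [← map_smul] at h1
    obtain ⟨v, hv1, hv, h1⟩ := exists_extMap_eq_zero_of_theta_eq_zero h1
    rw [smul_cls] at h1
    have hyv : ∀ i, y i ^ v = y i ^ (v - 1) * y i := fun i => by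
      rw [← pow_succ, Nat.sub_add_cancel hv1]
    have h2 := prod_smul_mem_of_smul_extMap_eq_zero hyv G.res φ hφ _ _ hv
      ((one_smul _ _).trans h1) (fun i => Ideal.pow_mem_pow (hyI i) v)
    have h3 : (x 0 ^ (w - 1) • (c ∘ₗ G.toSyz (n + 1))) ((φ.f (n + 1)).hom (koszulTop y)) = c m := by
      rw [LinearMap.smul_apply, LinearMap.comp_apply, ← map_smul, ← map_smul]
    rw [h3] at h2
    have h4 : ∀ t ∈ Ideal.span (Set.range fun i => y i ^ v) • (⊤ : Submodule S ω),
        Φ.symm (e v) t = 0 := by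
      intro t ht
      have : Ideal.span (Set.range fun i => y i ^ v) • (⊤ : Submodule S ω) ≤
          LinearMap.ker (Φ.symm (e v)) := by
        rw [Submodule.smul_le]
        intro r hr t _
        rw [LinearMap.mem_ker, map_smul, ← LinearMap.smul_apply, ← map_smul, he0 v r hr, map_zero,
          LinearMap.zero_apply]
      exact this ht
    rw [he v hv1, map_smul, LinearMap.smul_apply, ← map_smul]
    exact h4 _ h2
  have hfin : Module.Finite S (G.res.complex.X (n + 1)) := hG _
  have ht := tmul_eq_zero_of_forall_apply_eq_zero hE.injective_module m (Φ.symm (e 1)) hzero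
  have ht' := congrArg (TensorProduct.map LinearMap.id Φ.toLinearMap) ht
  rw [TensorProduct.map_tmul, map_zero, LinearMap.id_apply, LinearEquiv.coe_coe,
    LinearEquiv.apply_symm_apply] at ht'
  obtain ⟨v, hv, hbad⟩ := het _ m ht'
  refine h x q w hx G φ ((liftsMul_iff _ _).2 hφ) v hv ?_
  rw [BadRelation, map_smul]
  exact hbad

end Final

end CanonicalElement

end

theorem mainTheorem2 {S : Type u} [CommRing S] [IsLocalRing S] [IsNoetherianRing S]
    (d : ℕ) [NeZero d] (hd : ringKrullDim S = d) :
    List.TFAE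
      [CanonicalElement.MonomialForm S d,
        CanonicalElement.MonomialFormOne S d,
        CanonicalElement.LiftForm S d,
        CanonicalElement.EtaForm S d] ∧
    ∀ ω : ModuleCat.{u} S, CanonicalElement.IsCanonicalModule ω →
      List.TFAE
        [CanonicalElement.MonomialForm S d,
          CanonicalElement.MonomialFormOne S d,
          CanonicalElement.LiftForm S d,
          CanonicalElement.EtaForm S d,
          CanonicalElement.ExtNuForm d ω,
          CanonicalElement.ExtMulForm d ω] := by
  obtain ⟨n, rfl⟩ : ∃ n, d = n + 1 := Nat.exists_eq_succ_of_ne_zero (NeZero.ne d)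
  have h12 := CanonicalElement.monomialFormOne_of_monomialForm (S := S) (n := n)
  have h21 := CanonicalElement.monomialForm_of_monomialFormOne (S := S) (n := n)
  have h14 := CanonicalElement.etaForm_of_monomialForm (S := S) (n := n)
  have h43 := CanonicalElement.liftForm_of_etaForm (S := S) (n := n)
  have h32 := CanonicalElement.monomialFormOne_of_liftForm (S := S) (n := n)
  refine ⟨?_, fun ω hω => ?_⟩
  · tfae_have 1 → 4 := h14
    tfae_have 4 → 3 := h43
    tfae_have 3 → 2 := h32
    tfae_have 2 → 1 := h21
    tfae_finish
  · have h16 := CanonicalElement.extMulForm_of_monomialForm hd hω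
    have h64 := CanonicalElement.etaForm_of_extMulForm (n := n) (ω := ω)
    have h56 := CanonicalElement.extNuForm_iff_extMulForm (n := n) (ω := ω)
    tfae_have 1 → 6 := h16
    tfae_have 6 → 4 := h64
    tfae_have 4 → 3 := h43
    tfae_have 3 → 2 := h32
    tfae_have 2 → 1 := h21
    tfae_have 5 ↔ 6 := h56
    tfae_finish
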